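/- For an open set $\Omega\subset\mathbb C^n$ let $L^2_h(\Omega)$ be the space of holomorphic functions on $\Omega$ that are square integrable for Lebesgue measure, let $K_\Omega(z,w)$ be its reproducing kernel (the Bergman kernel: $K_\Omega(\cdot,w)\in L^2_h(\Omega)$ and $f(w)=\int_\Omega f(z)\overline{K_\Omega(z,w)}\,dV(z)$ for all $f\in L^2_h(\Omega)$, $w\in\Omega$), and let $$F_B^\Omega(p,\xi)=\Big(\sum_{\nu,\mu=1}^n\frac{\partial^2\log K_\Omega(z,z)}{\partial z_\nu\,\partial\overline{z_\mu}}\Big|_{z=p}\,\xi_\nu\overline{\xi_\mu}\Big)^{1/2},\qquad p\in\Omega,\ \xi\in\mathbb C^n,$$ be the Bergman metric. Let $\mathbb B^2=\{z\in\mathbb C^2:|z|<1\}$ and, for $r\in(0,1)$, $\Omega_r=\{z\in\mathbb C^2: r<|z|<1\}$. Proposition. There is $r_0\in(0,1)$ such that for every $r\in(0,r_0)$ there is $\varepsilon>0$ (which may depend on $r$) such that for every $z_0\in\Omega_r$ with $|z_0|<r+\varepsilon$, $$F_B^{\Omega_r}(z_0,N)<F_B^{\mathbb B^2}(z_0,N),\qquad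 N=\frac{z_0}{|z_0|}.$$ Here, as part of the assertion, the Bergman metrics of $\mathbb B^2$ and of $\Omega_r$ ($0<r<r_0$) are well defined: the Bergman kernel exists, is positive on the diagonal, and $\log K(z,z)$ is of class $C^2$ on the domain. -/

import Mathlib

open MeasureTheory Set
open scoped ContDiff ComplexConjugate

noncomputable section

/-- `ℂⁿ` with the Euclidean norm. -/
abbrev Cn (n : ℕ) : Type := EuclideanSpace ℂ (Fin n)

/-- Lebesgue measure on `ℂⁿ = ℝ²ⁿ`: the product of the planar Lebesgue measures. -/
def lebesgueCn (n : ℕ) : Measure (Cn n) :=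
  Measure.map (WithLp.toLp 2) (volume : Measure (Fin n → ℂ))

/-- `f` belongs to `L²_h(Ω)`: it is holomorphic on `Ω` and square integrable over `Ω`.
(Only the values of `f` on `Ω` matter.) -/
def IsBergmanFunction {n : ℕ} (Ω : Set (Cn n)) (f : Cn n → ℂ) : Prop :=
  DifferentiableOn ℂ f Ω ∧ MemLp f 2 ((lebesgueCn n).restrict Ω)

/-- `k` is the function of `L²_h(Ω)` that represents evaluation at `w`:
`f(w) = ⟨f, k⟩ = ∫_Ω f(z) * conj (k z) dV(z)` for all `f` in `L²_h(Ω)`.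
For open `Ω` and `w ∈ Ω` there is at most one such `k`, up to its values off `Ω`. -/
def IsReproducingAt {n : ℕ} (Ω : Set (Cn n)) (w : Cn n) (k : Cn n → ℂ) : Prop :=
  IsBergmanFunction Ω k ∧
    ∀ f : Cn n → ℂ, IsBergmanFunction Ω f →
      f w = ∫ z in Ω, f z * conj (k z) ∂(lebesgueCn n)

open Classical in
/-- The Bergman kernel `K_Ω(z, w)`, i.e. the reproducing kernel of `L²_h(Ω)`
(with value `0` where no reproducing function exists). -/
def bergmanKernel {n : ℕ} (Ω : Set (Cn n)) (z w : Cn n) : ℂ :=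
  if h : ∃ k : Cn n → ℂ, IsReproducingAt Ω w k then h.choose z else 0

/-- `log K_Ω(z, z)`; the number `K_Ω(z, z) = ‖K_Ω(·, z)‖²` is real. -/
def logBergmanDiag {n : ℕ} (Ω : Set (Cn n)) (z : Cn n) : ℝ :=
  Real.log (bergmanKernel Ω z z).re

/-- The Wirtinger derivative `∂g/∂z_ν = (∂g/∂x_ν - i ∂g/∂y_ν) / 2` at `p`. -/
def wirtinger {n : ℕ} (ν : Fin n) (g : Cn n → ℂ) (p : Cn n) : ℂ :=
  (fderiv ℝ g p (EuclideanSpace.single ν 1)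
    - Complex.I * fderiv ℝ g p (EuclideanSpace.single ν Complex.I)) / 2

/-- The Wirtinger derivative `∂g/∂z̄_μ = (∂g/∂x_μ + i ∂g/∂y_μ) / 2` at `p`. -/
def wirtingerBar {n : ℕ} (μ : Fin n) (g : Cn n → ℂ) (p : Cn n) : ℂ :=
  (fderiv ℝ g p (EuclideanSpace.single μ 1)
    + Complex.I * fderiv ℝ g p (EuclideanSpace.single μ Complex.I)) / 2

/-- The Levi form `∑_{ν, μ} ∂²u/∂z_ν∂z̄_μ (p) ξ_ν conj(ξ_μ)` of a real function `u`
(a real number when `u` is `C²` near `p`). -/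
def leviForm {n : ℕ} (u : Cn n → ℝ) (p ξ : Cn n) : ℝ :=
  (∑ ν : Fin n, ∑ μ : Fin n,
    wirtinger ν (wirtingerBar μ (fun z => ((u z : ℝ) : ℂ))) p * ξ ν * conj (ξ μ)).re

/-- The Bergman metric `F_B^Ω(p, ξ)`. -/
def bergmanMetric {n : ℕ} (Ω : Set (Cn n)) (p ξ : Cn n) : ℝ :=
  Real.sqrt (leviForm (logBergmanDiag Ω) p ξ)

/-- The Bergman metric of `Ω` is genuinely defined (no default value enters it): the
reproducing functions exist, the kernel does not vanish on the diagonal, and `log K_Ω(z, z)`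
is of class `C²` on `Ω`. -/
def BergmanMetricDefined {n : ℕ} (Ω : Set (Cn n)) : Prop :=
  (∀ w ∈ Ω, ∃ k : Cn n → ℂ, IsReproducingAt Ω w k) ∧
  (∀ z ∈ Ω, 0 < (bergmanKernel Ω z z).re) ∧
  ContDiffOn ℝ 2 (logBergmanDiag Ω) Ω

/-- The open unit ball of `ℂⁿ`. -/
def unitBallCn (n : ℕ) : Set (Cn n) := {z | ‖z‖ < 1}

/-- The ring domain `{r < |z| < 1}` of `ℂⁿ`. -/
def ringDomain (n : ℕ) (r : ℝ) : Set (Cn n) := {z | r < ‖z‖ ∧ ‖z‖ < 1}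

end

/-! A function in L²_h of the ring domain extends holomorphically across the hole (Hartogs), so the
space has the same orthogonal monomials as on the ball, and only their norms change. By unitary
invariance it suffices to reproduce values at (ρ, 0). Only the powers z₁ᵏ enter there, with ‖z₁ᵏ‖² =
π²(1 - qᵏ⁺²)/((k+1)(k+2)) and q = r². Hence K(z,w) = ∑ cₖ⟨z,w⟩ᵏ with cₖ = ‖z₁ᵏ‖⁻². The ball is the
case without the q-term; it is treated as the ring domain of radius -1. On the diagonal log K = ψ(t)
with t = |z|², and the Levi form in the direction z/|z| is ψ' + tψ''. For small t this is close to
c₁/c₀. Passing from ball to ring raises c₀ by a relative amount of order q² but c₁ only by order q³,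
so the quotient drops. For q < t < 4q the corrections from t and from higher coefficients are too
small to reverse this. The argument rests on `integral_mul_conj_monomial` (orthogonality),
`isReproducingAt_ringDomain` (the kernel), `leviForm_radial` (the Levi form) and
`radialLevi_perturbation` (the inequality). -/

open scoped Real Topology

/-! ### Power series with coefficients of polynomial growth -/

/-- A real sequence of at most polynomial growth. -/
def PolyBounded (a : ℕ → ℝ) : Prop :=
  ∃ (C : ℝ) (m : ℕ), ∀ k : ℕ, |a k| ≤ C * ((k : ℝ) + 1) ^ m

/-- The coefficients of the derivative of the power series `∑ aₖ xᵏ`. -/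
def derivCoeff (a : ℕ → ℝ) : ℕ → ℝ := fun k => ((k : ℝ) + 1) * a (k + 1)

/-- The sum of the power series `∑ aₖ xᵏ`. -/
noncomputable def powerSum {𝕜 : Type*} [RCLike 𝕜] (a : ℕ → ℝ) (x : 𝕜) : 𝕜 :=
  ∑' k : ℕ, (a k : 𝕜) * x ^ k

theorem PolyBounded.derivCoeff {a : ℕ → ℝ} (ha : PolyBounded a) : PolyBounded (derivCoeff a) := by
  obtain ⟨C, m, h⟩ := ha
  refine ⟨C * 2 ^ m, m + 1, fun k => ?_⟩
  have h1 := h (k + 1)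
  have hC : 0 ≤ C := by simpa using (abs_nonneg _).trans (h 0)
  have hk : (0 : ℝ) ≤ k := k.cast_nonneg
  rw [_root_.derivCoeff, abs_mul, abs_of_nonneg (by positivity : (0 : ℝ) ≤ (k : ℝ) + 1)]
  calc ((k : ℝ) + 1) * |a (k + 1)|
      ≤ ((k : ℝ) + 1) * (C * (2 * ((k : ℝ) + 1)) ^ m) := by
        gcongr
        refine h1.trans ?_
        gcongr
        push_cast
        linarith
    _ = C * 2 ^ m * ((k : ℝ) + 1) ^ (m + 1) := by rw [mul_pow]; ring

theorem PolyBounded.summable {a : ℕ → ℝ} (ha : PolyBounded a) {R : ℝ} (h0 : 0 ≤ R) (h1 : R < 1) :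
    Summable fun k => |a k| * R ^ k := by
  obtain ⟨C, m, h⟩ := ha
  have hC : 0 ≤ C := by simpa using (abs_nonneg _).trans (h 0)
  have hs := summable_pow_mul_geometric_of_norm_lt_one m
    (show ‖R‖ < 1 by rwa [Real.norm_of_nonneg h0])
  have hg := summable_geometric_of_lt_one h0 h1
  refine Summable.of_nonneg_of_le (fun k => by positivity) (fun k => ?_)
    ((hs.mul_left (C * 2 ^ m)).add (hg.mul_left C))
  have key : ((k : ℝ) + 1) ^ m ≤ 2 ^ m * (k : ℝ) ^ m + 1 := by
    rcases Nat.eq_zero_or_pos k with rfl | hk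
    · simp
    · have : (1 : ℝ) ≤ k := by exact_mod_cast hk
      calc ((k : ℝ) + 1) ^ m ≤ (2 * k) ^ m := by gcongr; linarith
        _ = 2 ^ m * (k : ℝ) ^ m := mul_pow _ _ _
        _ ≤ _ := by linarith
  calc |a k| * R ^ k ≤ C * (2 ^ m * (k : ℝ) ^ m + 1) * R ^ k := by
        gcongr
        exact (h k).trans (by gcongr)
    _ = _ := by ring

theorem PolyBounded.norm_summable {𝕜 : Type*} [RCLike 𝕜] {a : ℕ → ℝ} (ha : PolyBounded a) {x : 𝕜}
    (hx : ‖x‖ < 1) : Summable fun k => ‖(a k : 𝕜) * x ^ k‖ := by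
  simpa using ha.summable (norm_nonneg x) hx

/-- Termwise differentiation, dominated on a ball of radius R strictly between ‖x‖ and 1. The case 𝕜
= ℂ makes the kernel holomorphic; the case 𝕜 = ℝ serves its restriction to the diagonal. -/
theorem PolyBounded.hasDerivAt {𝕜 : Type*} [RCLike 𝕜] {a : ℕ → ℝ} (ha : PolyBounded a) {x : 𝕜}
    (hx : ‖x‖ < 1) : HasDerivAt (powerSum a) (powerSum (_root_.derivCoeff a) x) x := by
  obtain ⟨R, hxR, hR1⟩ := exists_between hx
  have hR0 : 0 ≤ R := (norm_nonneg x).trans hxR.le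
  have hu0 : Summable fun k : ℕ => |a (k + 1)| * (((k : ℝ) + 1) * R ^ k) := by
    refine (ha.derivCoeff.summable hR0 hR1).congr fun k => ?_
    rw [_root_.derivCoeff, abs_mul, abs_of_nonneg (by positivity : (0 : ℝ) ≤ (k : ℝ) + 1)]
    ring
  have hu : Summable fun k : ℕ => |a k| * ((k : ℝ) * R ^ (k - 1)) := by
    rw [← summable_nat_add_iff 1]
    refine hu0.congr fun k => ?_
    simp
  have hmem : ∀ y ∈ Metric.ball (0 : 𝕜) R, ‖y‖ < R := fun y hy => by simpa using hy
  have hnorm : ∀ (n : ℕ) (y : 𝕜), y ∈ Metric.ball (0 : 𝕜) R →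
      ‖(a n : 𝕜) * ((n : 𝕜) * y ^ (n - 1))‖ ≤ |a n| * ((n : ℝ) * R ^ (n - 1)) := fun n y hy => by
    rw [norm_mul, norm_mul, norm_pow, RCLike.norm_ofReal, RCLike.norm_natCast]
    have := (hmem y hy).le
    gcongr
  have hmain := hasDerivAt_tsum_of_isPreconnected (𝕜 := 𝕜) (F := 𝕜)
    (g := fun k y => (a k : 𝕜) * y ^ k)
    (g' := fun k y => (a k : 𝕜) * ((k : 𝕜) * y ^ (k - 1))) (t := Metric.ball (0 : 𝕜) R)
    (y₀ := x) (y := x) hu Metric.isOpen_ball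
    (letI := NormedSpace.restrictScalars ℝ 𝕜 𝕜; (convex_ball (0 : 𝕜) R).isPreconnected)
    (fun n y _ => (hasDerivAt_pow n y).const_mul _) hnorm
    (by simpa using hxR) (ha.norm_summable hx).of_norm (by simpa using hxR)
  have hs : Summable fun k : ℕ => (a k : 𝕜) * ((k : 𝕜) * x ^ (k - 1)) :=
    (hu.of_nonneg_of_le (fun _ => norm_nonneg _) fun n => hnorm n x (by simpa using hxR)).of_norm
  have heq : powerSum (_root_.derivCoeff a) x =
      ∑' k : ℕ, (a k : 𝕜) * ((k : 𝕜) * x ^ (k - 1)) := by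
    rw [hs.tsum_eq_zero_add, powerSum]
    simp only [CharP.cast_eq_zero, zero_mul, mul_zero, zero_add]
    refine tsum_congr fun k => ?_
    simp [_root_.derivCoeff]
    ring
  rw [heq]
  exact hmain

theorem PolyBounded.contDiffOn {a : ℕ → ℝ} (n : ℕ) (ha : PolyBounded a) :
    ContDiffOn ℝ n (powerSum a : ℝ → ℝ) (Ioo (-1) 1) := by
  have hlt : ∀ x ∈ Ioo (-1 : ℝ) 1, ‖x‖ < 1 := fun x hx => abs_lt.2 hx
  induction n generalizing a with
  | zero =>
    exact contDiffOn_zero.2 fun x hx =>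
      (ha.hasDerivAt (hlt x hx)).continuousAt.continuousWithinAt
  | succ n ih =>
    push_cast
    rw [contDiffOn_succ_iff_deriv_of_isOpen isOpen_Ioo]
    refine ⟨fun x hx => (ha.hasDerivAt (hlt x hx)).differentiableAt.differentiableWithinAt,
      by simp, (ih ha.derivCoeff).congr fun x hx => (ha.hasDerivAt (hlt x hx)).deriv⟩

/-! ### Planar integrals as integrals of circular means -/

theorem Complex.integrable_comp_polarCoord_symm {F : ℂ → ℂ} (hF : Integrable F) :
    IntegrableOn (fun p : ℝ × ℝ => p.1 • F (Complex.polarCoord.symm p)) polarCoord.target := by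
  have h1 : Integrable (fun p : ℝ × ℝ => F (Complex.measurableEquivRealProd.symm p)) :=
    (Complex.volume_preserving_equiv_real_prod.symm).integrable_comp_of_integrable hF
  have h2 := (integrableOn_image_iff_integrableOn_abs_det_fderiv_smul volume
    polarCoord.open_target.measurableSet
    (fun p _ => (hasFDerivAt_polarCoord_symm p).hasFDerivWithinAt)
    polarCoord.symm.injOn
    (fun p : ℝ × ℝ => F (Complex.measurableEquivRealProd.symm p))).1 h1.integrableOn
  refine h2.congr_fun (fun p hp => ?_) polarCoord.open_target.measurableSet
  have hp0 : 0 < p.1 := hp.1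
  simp only [det_fderivPolarCoordSymm, abs_of_pos hp0]
  rw [Complex.measurableEquivRealProd_symm_polarCoord_symm_apply]

theorem circleAverage_eq_integral_polar (F : ℂ → ℂ) (s : ℝ) :
    ∫ θ in Ioo (-π) π, F (Complex.polarCoord.symm (s, θ)) =
      (2 * π) • Real.circleAverage F 0 s := by
  rw [Real.circleAverage_def, smul_smul, mul_inv_cancel₀ (by positivity), one_smul,
    ← integral_Ioc_eq_integral_Ioo, ← intervalIntegral.integral_of_le (by linarith [Real.pi_pos])]
  have hp : Function.Periodic (fun θ => F (circleMap 0 s θ)) (2 * π) :=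
    (periodic_circleMap 0 s).comp F
  have := hp.intervalIntegral_add_eq (-π) 0
  rw [zero_add, show -π + 2 * π = π by ring] at this
  rw [← this]
  refine intervalIntegral.integral_congr fun θ _ => ?_
  simp [circleMap, Complex.exp_mul_I]

theorem Complex.integral_eq_integral_circleAverage {F : ℂ → ℂ} (hF : Integrable F) :
    ∫ z, F z = ∫ s in Ioi (0 : ℝ), (2 * π * s) • Real.circleAverage F 0 s := by
  rw [← Complex.integral_comp_polarCoord_symm]
  have h := Complex.integrable_comp_polarCoord_symm hF
  rw [show polarCoord.target = Ioi (0 : ℝ) ×ˢ Ioo (-π) π from rfl] at h ⊢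
  rw [Measure.volume_eq_prod] at h ⊢
  rw [setIntegral_prod _ h]
  refine setIntegral_congr_fun measurableSet_Ioi fun s _ => ?_
  simp only
  rw [integral_smul, circleAverage_eq_integral_polar, smul_smul]
  congr 1
  ring

/-! ### Coordinates, Lebesgue measure and unitary maps -/

/-- The point `(a, b)` of `ℂ²`. -/
def pointC2 (a b : ℂ) : Cn 2 := !₂[a, b]

theorem norm_sq_pointC2 (a b : ℂ) : ‖pointC2 a b‖ ^ 2 = ‖a‖ ^ 2 + ‖b‖ ^ 2 := by
  simp [pointC2, EuclideanSpace.norm_sq_eq]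

theorem pointC2_eta (z : Cn 2) : pointC2 (z 0) (z 1) = z := by
  ext i
  fin_cases i <;> simp [pointC2]

theorem differentiable_pointC2 : Differentiable ℂ fun p : ℂ × ℂ => pointC2 p.1 p.2 := by
  unfold pointC2
  rw [differentiable_euclidean]
  intro i
  fin_cases i
  · exact differentiable_fst
  · exact differentiable_snd

theorem continuous_pointC2 : Continuous fun p : ℂ × ℂ => pointC2 p.1 p.2 :=
  differentiable_pointC2.continuous

theorem measurableEmbedding_pointC2 : MeasurableEmbedding fun p : ℂ × ℂ => pointC2 p.1 p.2 :=
  (MeasurableEquiv.finTwoArrow.symm.trans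
    (MeasurableEquiv.toLp 2 (Fin 2 → ℂ))).measurableEmbedding

theorem measurePreserving_pointC2 :
    MeasurePreserving (fun p : ℂ × ℂ => pointC2 p.1 p.2) volume (lebesgueCn 2) := by
  have h1 := (volume_preserving_finTwoArrow ℂ).symm
  have h2 : MeasurePreserving (WithLp.toLp 2) (volume : Measure (Fin 2 → ℂ)) (lebesgueCn 2) :=
    ⟨WithLp.measurable_toLp 2 _, rfl⟩
  exact h2.comp h1

instance (n : ℕ) : (lebesgueCn n).IsAddHaarMeasure := by
  unfold lebesgueCn
  exact (PiLp.continuousLinearEquiv 2 ℂ (fun _ : Fin n => ℂ)).symm.isAddHaarMeasure_map volume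

/-- By uniqueness of Haar measure the image measure is a multiple of μ; the unit ball is its own
preimage and has finite nonzero measure, so the factor is 1. -/
theorem LinearIsometryEquiv.measurePreserving_addHaar {E : Type*} [NormedAddCommGroup E]
    [NormedSpace ℂ E] [FiniteDimensional ℂ E] [MeasurableSpace E] [BorelSpace E]
    (μ : Measure E) [μ.IsAddHaarMeasure] (V : E ≃ₗᵢ[ℂ] E) : MeasurePreserving V μ μ := by
  let _ : NormedSpace ℝ E := NormedSpace.restrictScalars ℝ ℂ E
  have : FiniteDimensional ℝ E := FiniteDimensional.complexToReal E
  refine ⟨V.continuous.measurable, ?_⟩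
  have : (μ.map V).IsAddHaarMeasure := V.toContinuousLinearEquiv.isAddHaarMeasure_map μ
  have h := Measure.isAddLeftInvariant_eq_smul (μ.map V) μ
  have h1 : (μ.map V) (Metric.ball 0 1) = μ (Metric.ball 0 1) := by
    rw [Measure.map_apply V.continuous.measurable Metric.isOpen_ball.measurableSet]
    simp
  rw [h, Measure.smul_apply] at h1
  have h0 : μ (Metric.ball (0 : E) 1) ≠ 0 := (Metric.measure_ball_pos μ 0 one_pos).ne'
  have ht : μ (Metric.ball (0 : E) 1) ≠ ⊤ := measure_ball_lt_top.ne
  have h2 : ((Measure.addHaarScalarFactor (μ.map V) μ : NNReal) : ENNReal)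
      * μ (Metric.ball 0 1) = 1 * μ (Metric.ball 0 1) := by
    rw [one_mul]
    exact h1
  have h3 : Measure.addHaarScalarFactor (μ.map V) μ = 1 := by
    exact_mod_cast (ENNReal.mul_left_inj h0 ht).1 h2
  rw [h, h3, one_smul]

/-! ### Hartogs extension on slices -/

theorem differentiableOn_intervalIntegral_of_continuousOn {U : Set ℂ} (hU : IsOpen U)
    {F : ℂ → ℝ → ℂ} {a b : ℝ} (hc : ContinuousOn (fun p : ℂ × ℝ => F p.1 p.2) (U ×ˢ univ))
    (hd : ∀ θ, DifferentiableOn ℂ (fun z => F z θ) U) :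
    DifferentiableOn ℂ (fun z => ∫ θ in a..b, F z θ) U := by
  intro z₀ hz₀
  obtain ⟨R, hR, hRU⟩ := Metric.nhds_basis_closedBall.mem_iff.1 (hU.mem_nhds hz₀)
  have hcz : ∀ z ∈ U, Continuous (F z) := fun z hz => by
    rw [← continuousOn_univ]
    exact hc.comp (by fun_prop : Continuous fun θ : ℝ => (z, θ)).continuousOn
      fun θ _ => ⟨hz, mem_univ _⟩
  have hK : IsCompact (Metric.closedBall z₀ R ×ˢ uIcc a b) :=
    (isCompact_closedBall z₀ R).prod isCompact_uIcc
  obtain ⟨M, hM⟩ := hK.exists_bound_of_continuousOn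
    (hc.mono (prod_mono hRU (subset_univ _)))
  have hdat : ∀ θ, ∀ z ∈ Metric.ball z₀ R, HasDerivAt (fun z => F z θ)
      (deriv (fun z => F z θ) z) z := fun θ z hz =>
    ((hd θ).differentiableAt (hU.mem_nhds (hRU (Metric.ball_subset_closedBall hz)))).hasDerivAt
  -- The derivative is measurable in θ as a pointwise limit of continuous difference quotients.
  have hmeas : AEStronglyMeasurable (fun θ => deriv (fun z => F z θ) z₀)
      (volume.restrict (uIoc a b)) := by
    refine aestronglyMeasurable_of_tendsto_ae (Filter.atTop : Filter ℕ)
      (f := fun n θ => ((R / (n + 2) : ℝ) : ℂ)⁻¹ • (F (z₀ + ((R / (n + 2) : ℝ) : ℂ)) θ - F z₀ θ))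
      (fun n => ?_) (Filter.Eventually.of_forall fun θ => ?_)
    · have hmem : z₀ + ((R / (n + 2) : ℝ) : ℂ) ∈ Metric.closedBall z₀ R := by
        simp only [Metric.mem_closedBall, dist_self_add_left, Complex.norm_real, Real.norm_eq_abs]
        rw [abs_of_pos (by positivity)]
        exact div_le_self hR.le (by linarith [(n.cast_nonneg : (0 : ℝ) ≤ n)])
      have h1 := hcz _ (hRU hmem)
      have h2 := hcz z₀ hz₀
      exact Continuous.aestronglyMeasurable (by fun_prop)
    · have h1 := (hdat θ z₀ (Metric.mem_ball_self hR)).tendsto_slope_zero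
      have h2 : Filter.Tendsto (fun n : ℕ => ((R / (n + 2) : ℝ) : ℂ)) Filter.atTop (𝓝[≠] 0) := by
        rw [tendsto_nhdsWithin_iff]
        constructor
        · rw [← Complex.ofReal_zero]
          refine (Complex.continuous_ofReal.tendsto 0).comp ?_
          exact Filter.Tendsto.div_atTop tendsto_const_nhds
            (Filter.tendsto_atTop_add_const_right _ _ tendsto_natCast_atTop_atTop)
        · refine Filter.Eventually.of_forall fun n => ?_
          have : (R / (n + 2) : ℝ) ≠ 0 := by positivity
          simpa only [mem_compl_iff, mem_singleton_iff, Complex.ofReal_eq_zero] using this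
      exact h1.comp h2
  have hR2 : Metric.ball z₀ (R / 2) ∈ 𝓝 z₀ := Metric.ball_mem_nhds _ (by positivity)
  have := intervalIntegral.hasDerivAt_integral_of_dominated_loc_of_deriv_le (μ := volume)
    (F := F) (F' := fun z θ => deriv (fun z => F z θ) z) (x₀ := z₀) (a := a) (b := b)
    (bound := fun _ => M / (R / 2)) hR2
    (by
      filter_upwards [hU.mem_nhds hz₀] with z hz
      exact (hcz z hz).aestronglyMeasurable)
    ((hcz z₀ hz₀).intervalIntegrable _ _) hmeas
    -- Cauchy's estimate on the disc of radius R/2 about z bounds the derivative uniformly.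
    (Filter.Eventually.of_forall fun θ hθ z hz => by
      have hsub : Metric.closedBall z (R / 2) ⊆ Metric.closedBall z₀ R := by
        refine Metric.closedBall_subset_closedBall' ?_
        have := Metric.mem_ball.1 hz
        linarith
      refine Complex.norm_deriv_le_of_forall_mem_sphere_norm_le (by positivity) ?_ ?_
      · refine DifferentiableOn.diffContOnCl ?_
        rw [closure_ball _ (by positivity)]
        exact (hd θ).mono (hsub.trans hRU)
      · intro w hw
        exact hM (w, θ) ⟨hsub (Metric.sphere_subset_closedBall hw), uIoc_subset_uIcc hθ⟩)
    (by simp)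
    (Filter.Eventually.of_forall fun θ _ z hz =>
      hdat θ z (Metric.ball_subset_ball (by linarith) hz))
  exact this.2.differentiableAt.differentiableWithinAt

theorem isOpen_ringDomain (n : ℕ) (r : ℝ) : IsOpen (ringDomain n r) :=
  (isOpen_lt continuous_const continuous_norm).inter (isOpen_lt continuous_norm continuous_const)

theorem pointC2_mem_ringDomain {r : ℝ} {a b : ℂ} (h : r < ‖a‖ ∨ r < ‖b‖)
    (h1 : ‖a‖ ^ 2 + ‖b‖ ^ 2 < 1) : pointC2 a b ∈ ringDomain 2 r := by
  rw [← norm_sq_pointC2] at h1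
  refine ⟨?_, (sq_lt_one_iff₀ (norm_nonneg _)).1 h1⟩
  have ha : ‖a‖ ≤ ‖pointC2 a b‖ := abs_le_of_sq_le_sq' (by
    rw [norm_sq_pointC2]; nlinarith [sq_nonneg ‖b‖]) (norm_nonneg _) |>.2
  have hb : ‖b‖ ≤ ‖pointC2 a b‖ := abs_le_of_sq_le_sq' (by
    rw [norm_sq_pointC2]; nlinarith [sq_nonneg ‖a‖]) (norm_nonneg _) |>.2
  rcases h with h | h
  · exact h.trans_le ha
  · exact h.trans_le hb

section Hartogs

variable {r : ℝ} {f : Cn 2 → ℂ}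

theorem differentiableAt_slice_snd (hf : DifferentiableOn ℂ f (ringDomain 2 r)) {a b : ℂ}
    (h : pointC2 a b ∈ ringDomain 2 r) : DifferentiableAt ℂ (fun w => f (pointC2 a w)) b :=
  DifferentiableAt.comp b (hf.differentiableAt ((isOpen_ringDomain 2 r).mem_nhds h))
    ((differentiable_pointC2 (a, b)).comp b (f := fun w => (a, w)) (by fun_prop))

theorem differentiableAt_slice_fst (hf : DifferentiableOn ℂ f (ringDomain 2 r)) {a b : ℂ}
    (h : pointC2 a b ∈ ringDomain 2 r) : DifferentiableAt ℂ (fun w => f (pointC2 w b)) a :=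
  DifferentiableAt.comp a (hf.differentiableAt ((isOpen_ringDomain 2 r).mem_nhds h))
    ((differentiable_pointC2 (a, b)).comp a (f := fun w => (w, b)) (by fun_prop))

/-- Because ‖a‖ > r, the slice contains the whole disc, and the mean value property applies. -/
theorem circleAverage_slice_of_disc (hf : DifferentiableOn ℂ f (ringDomain 2 r)) {a : ℂ} {s : ℝ}
    (ha : r < ‖a‖) (hs : ‖a‖ ^ 2 + s ^ 2 < 1) :
    Real.circleAverage (fun w => f (pointC2 a w)) 0 s = f (pointC2 a 0) := by
  have hd : ∀ w ∈ Metric.closedBall (0 : ℂ) |s|,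
      DifferentiableAt ℂ (fun w => f (pointC2 a w)) w := by
    intro w hw
    refine differentiableAt_slice_snd hf (pointC2_mem_ringDomain (Or.inl ha) ?_)
    have : ‖w‖ ^ 2 ≤ s ^ 2 := by
      rw [← sq_abs s]
      have : ‖w‖ ≤ |s| := by simpa using hw
      gcongr
    linarith
  exact circleAverage_of_differentiable_on_off_countable countable_empty
    (fun w hw => (hd w hw).continuousAt.continuousWithinAt)
    fun w hw => hd w (Metric.ball_subset_closedBall hw.1)

/-- The closed annulus between the two circles lies in the slice, so Cauchy's theorem applies even
if the disc meets the hole. -/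
theorem circleAverage_slice_of_annulus (hf : DifferentiableOn ℂ f (ringDomain 2 r)) {a : ℂ}
    {s t : ℝ} (hs : 0 < s) (hst : s ≤ t) (h0 : pointC2 a s ∈ ringDomain 2 r)
    (h1 : ‖a‖ ^ 2 + t ^ 2 < 1) :
    Real.circleAverage (fun w => f (pointC2 a w)) 0 s =
      Real.circleAverage (fun w => f (pointC2 a w)) 0 t := by
  have hd : ∀ w : ℂ, s ≤ ‖w‖ → ‖w‖ ≤ t → DifferentiableAt ℂ (fun w => f (pointC2 a w)) w := by
    intro w hsw hwt
    refine differentiableAt_slice_snd hf ⟨h0.1.trans_le ?_, ?_⟩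
    · refine abs_le_of_sq_le_sq' ?_ (norm_nonneg _) |>.2
      rw [norm_sq_pointC2, norm_sq_pointC2, Complex.norm_real, Real.norm_of_nonneg hs.le]
      gcongr
    · refine (sq_lt_one_iff₀ (norm_nonneg _)).1 ?_
      rw [norm_sq_pointC2]
      refine lt_of_le_of_lt ?_ h1
      gcongr
  rw [Real.circleAverage_eq_circleIntegral hs.ne',
    Real.circleAverage_eq_circleIntegral (hs.trans_le hst).ne']
  congr 1
  refine (Complex.circleIntegral_sub_center_inv_smul_eq_of_differentiable_on_annulus_off_countable
    hs hst countable_empty (fun w hw => ?_) fun w hw => ?_).symm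
  · exact (hd w (by simpa using hw.2) (by simpa using hw.1)).continuousAt.continuousWithinAt
  · exact hd w (le_of_lt (by simpa using hw.1.2)) (le_of_lt (by simpa using hw.1.1))

/-- The restriction to `{z₂ = 0}` of the holomorphic extension of `f` from the ring domain to the
ball, written with the help of circular means. -/
noncomputable def hartogsSlice (f : Cn 2 → ℂ) (z : ℂ) : ℂ :=
  -- Since 2 · (7/10)² < 1, the circle of radius 7/10 over such z stays in the ball; it avoids the
  -- hole when r < 7/10.
  if ‖z‖ < 7 / 10 then Real.circleAverage (fun w => f (pointC2 z w)) 0 (7 / 10)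
  else f (pointC2 z 0)

theorem hartogsSlice_eq (hf : DifferentiableOn ℂ f (ringDomain 2 r)) {z : ℂ} (h : r < ‖z‖) :
    hartogsSlice f z = f (pointC2 z 0) := by
  unfold hartogsSlice
  split_ifs with hz
  · refine circleAverage_slice_of_disc hf h ?_
    nlinarith [norm_nonneg z]
  · rfl

/-- If ‖z‖ > r both sides are the value at the centre. Otherwise ‖z‖ < 7/10, and the circle can be
deformed to radius 7/10 without leaving the ring domain. -/
theorem circleAverage_eq_hartogsSlice (hr : r < 7 / 10)
    (hf : DifferentiableOn ℂ f (ringDomain 2 r)) {z : ℂ} {s : ℝ} (hs : 0 < s)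
    (h : pointC2 z s ∈ ringDomain 2 r) :
    Real.circleAverage (fun w => f (pointC2 z w)) 0 s = hartogsSlice f z := by
  have h1 : ‖z‖ ^ 2 + s ^ 2 < 1 := by
    have := (sq_lt_one_iff₀ (norm_nonneg _)).2 h.2
    rwa [norm_sq_pointC2, Complex.norm_real, Real.norm_of_nonneg hs.le] at this
  by_cases hz : r < ‖z‖
  · rw [hartogsSlice_eq hf hz, circleAverage_slice_of_disc hf hz h1]
  · have hz' : ‖z‖ < 7 / 10 := (not_lt.1 hz).trans_lt hr
    have hz2 : ‖z‖ ^ 2 + (7 / 10) ^ 2 < 1 := by nlinarith [norm_nonneg z]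
    rw [hartogsSlice, if_pos hz']
    rcases le_total s (7 / 10) with hle | hle
    · exact circleAverage_slice_of_annulus hf hs hle h hz2
    · refine (circleAverage_slice_of_annulus hf (by norm_num) hle ?_ h1).symm
      refine pointC2_mem_ringDomain (Or.inr ?_) ?_
      · rw [Complex.norm_real]; norm_num; linarith
      · rw [Complex.norm_real]; norm_num; linarith

theorem differentiableOn_hartogsSlice (hr : r < 7 / 10)
    (hf : DifferentiableOn ℂ f (ringDomain 2 r)) :
    DifferentiableOn ℂ (hartogsSlice f) (Metric.ball 0 1) := by
  have hmem : ∀ z : ℂ, ‖z‖ < 7 / 10 → ∀ θ : ℝ,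
      pointC2 z (circleMap 0 (7 / 10) θ) ∈ ringDomain 2 r := fun z hz θ => by
    have hn : ‖circleMap 0 (7 / 10) θ‖ = 7 / 10 := by
      rw [norm_circleMap_zero]; norm_num
    refine pointC2_mem_ringDomain (Or.inr (by rwa [hn])) ?_
    rw [hn]
    nlinarith [norm_nonneg z]
  have hA : DifferentiableOn ℂ
      (fun z => Real.circleAverage (fun w => f (pointC2 z w)) 0 (7 / 10))
      (Metric.ball 0 (7 / 10)) := by
    unfold Real.circleAverage
    refine DifferentiableOn.const_smul (differentiableOn_intervalIntegral_of_continuousOn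
      Metric.isOpen_ball (F := fun z θ => f (pointC2 z (circleMap 0 (7 / 10) θ))) ?_ ?_) _
    · refine hf.continuousOn.comp (t := ringDomain 2 r)
        (f := fun p : ℂ × ℝ => pointC2 p.1 (circleMap 0 (7 / 10) p.2)) ?_ ?_
      · exact (continuous_pointC2.comp (continuous_fst.prodMk
          ((continuous_circleMap 0 (7 / 10)).comp continuous_snd))).continuousOn
      · exact fun p hp => hmem _ (by simpa using hp.1) _
    · exact fun θ z hz =>
        (differentiableAt_slice_fst hf (hmem z (by simpa using hz) θ)).differentiableWithinAt
  intro z hz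
  have hz1 : ‖z‖ < 1 := by simpa using hz
  refine DifferentiableAt.differentiableWithinAt ?_
  by_cases h : ‖z‖ < 7 / 10
  · refine (hA.differentiableAt (Metric.isOpen_ball.mem_nhds (by simpa using h))).congr_of_eventuallyEq ?_
    filter_upwards [(isOpen_lt continuous_norm continuous_const).mem_nhds h] with y hy
    exact if_pos hy
  · have hrz : r < ‖z‖ := hr.trans_le (not_lt.1 h)
    have hm : pointC2 z 0 ∈ ringDomain 2 r := pointC2_mem_ringDomain (Or.inl hrz) (by
      simpa using hz1)
    refine (differentiableAt_slice_fst hf hm).congr_of_eventuallyEq ?_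
    filter_upwards [(isOpen_lt continuous_const continuous_norm).mem_nhds hrz] with y hy
    exact hartogsSlice_eq hf hy

end Hartogs

/-! ### Integrals against monomials -/

theorem exists_taylor_circleAverage {h : ℂ → ℂ} (hh : DifferentiableOn ℂ h (Metric.ball 0 1)) :
    ∃ c : ℕ → ℂ, (∀ z : ℂ, ‖z‖ < 1 → HasSum (fun k => c k * z ^ k) (h z)) ∧
      ∀ (k : ℕ) (s : ℝ), 0 < s → s < 1 →
        Real.circleAverage (fun z => conj z ^ k * h z) 0 s = (s : ℂ) ^ (2 * k) * c k := by
  refine ⟨fun k => ((k.factorial : ℂ))⁻¹ * iteratedDeriv k h 0, fun z hz => ?_,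
    fun k s hs hs1 => ?_⟩
  · have := Complex.hasSum_taylorSeries_on_ball (r := 1) (c := 0) (f := h) (by simpa using hh)
      (z := z) (by simpa using hz)
    have heq : (fun k : ℕ => ((k.factorial : ℂ))⁻¹ * iteratedDeriv k h 0 * z ^ k) =
        fun k : ℕ => ((k.factorial : ℂ))⁻¹ • (z - 0) ^ k • iteratedDeriv k h 0 := by
      funext k
      simp only [sub_zero, smul_eq_mul]
      ring
    rw [heq]
    exact this
  · have hsub : Metric.closedBall (0 : ℂ) s ⊆ Metric.ball 0 1 := Metric.closedBall_subset_ball hs1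
    have hd : DiffContOnCl ℂ h (Metric.ball 0 s) := by
      refine DifferentiableOn.diffContOnCl ?_
      rw [closure_ball _ hs.ne']
      exact hh.mono hsub
    have hc := hd.circleIntegral_one_div_sub_center_pow_smul hs k
    rw [Real.circleAverage_eq_circleIntegral hs.ne']
    have hpi : (2 * π * Complex.I : ℂ) ≠ 0 := by
      simp [Real.pi_ne_zero]
    -- On |z| = s one has conj z = s²/z, which turns the mean into Cauchy's integral for the k-th
    -- Taylor coefficient.
    have hcongr : (∮ z in C(0, s), (z - 0)⁻¹ • (conj z ^ k * h z)) =
        ∮ z in C(0, s), (s : ℂ) ^ (2 * k) • ((1 / (z - 0) ^ (k + 1)) • h z) := by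
      refine circleIntegral.integral_congr hs.le fun z hz => ?_
      have hzn : ‖z‖ = s := by simpa using hz
      have hz0 : z ≠ 0 := by
        rw [← norm_pos_iff, hzn]; exact hs
      have hzz : conj z * z = (s : ℂ) ^ 2 := by
        rw [Complex.conj_mul', hzn]
      have hzc : conj z = (s : ℂ) ^ 2 / z := by
        rw [← hzz]; field_simp
      simp only [sub_zero, smul_eq_mul, hzc, div_pow, pow_mul]
      field_simp
      ring
    rw [hcongr, circleIntegral.integral_smul, hc]
    simp only [smul_eq_mul]
    field_simp

theorem integral_ring_radii {a b : ℝ} (ha : 0 ≤ a) (hab : a ≤ b) :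
    ∫ s in Ioi (0 : ℝ), (Ioo a b).indicator (fun s => 2 * π * s) s = π * (b ^ 2 - a ^ 2) := by
  have hsub : Ioi (0 : ℝ) ∩ Ioo a b = Ioo a b := inter_eq_right.2 fun x hx => ha.trans_lt hx.1
  rw [setIntegral_indicator measurableSet_Ioo, hsub, ← integral_Ioc_eq_integral_Ioo,
    ← intervalIntegral.integral_of_le hab, intervalIntegral.integral_const_mul, integral_id]
  ring

/-- This is ∫|z₁|²ᵏ over the ball of radius R: the slice over |z₁| = t is a disc of area π(R² - t²),
or empty. -/
theorem integral_pow_mul_max {R : ℝ} (hR : 0 ≤ R) (k : ℕ) :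
    IntegrableOn (fun t : ℝ => 2 * π * t * t ^ (2 * k) * (π * max (R ^ 2 - t ^ 2) 0)) (Ioi 0) ∧
    ∫ t in Ioi (0 : ℝ), 2 * π * t * t ^ (2 * k) * (π * max (R ^ 2 - t ^ 2) 0) =
      π ^ 2 * R ^ (2 * (k + 2)) / ((k + 1) * (k + 2)) := by
  have heq : EqOn (fun t : ℝ => 2 * π * t * t ^ (2 * k) * (π * max (R ^ 2 - t ^ 2) 0))
      ((Ioc 0 R).indicator
        fun t => 2 * π ^ 2 * (R ^ 2 * t ^ (2 * k + 1) - t ^ (2 * k + 3))) (Ioi 0) := by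
    intro t ht
    have ht0 : 0 < t := ht
    by_cases h : t ≤ R
    · have : t ^ 2 ≤ R ^ 2 := by gcongr
      simp only [indicator_of_mem (show t ∈ Ioc 0 R from ⟨ht, h⟩)]
      rw [max_eq_left (by linarith)]
      ring
    · have : R ^ 2 ≤ t ^ 2 := by
        have := not_le.1 h
        gcongr
      simp only [indicator_of_notMem (show t ∉ Ioc 0 R from fun h' => h h'.2)]
      rw [max_eq_right (by linarith)]
      ring
  have hcont : Continuous fun t : ℝ => 2 * π ^ 2 * (R ^ 2 * t ^ (2 * k + 1) - t ^ (2 * k + 3)) := by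
    fun_prop
  have hsub : Ioi (0 : ℝ) ∩ Ioc 0 R = Ioc 0 R := inter_eq_right.2 fun x hx => hx.1
  constructor
  · refine IntegrableOn.congr_fun ?_ heq.symm measurableSet_Ioi
    refine Integrable.integrableOn ?_
    rw [integrable_indicator_iff measurableSet_Ioc]
    exact (hcont.integrableOn_Icc).mono_set Ioc_subset_Icc_self
  · rw [setIntegral_congr_fun measurableSet_Ioi heq, setIntegral_indicator measurableSet_Ioc, hsub,
      ← intervalIntegral.integral_of_le hR, intervalIntegral.integral_const_mul,
      intervalIntegral.integral_sub (by apply Continuous.intervalIntegrable; fun_prop)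
        (by apply Continuous.intervalIntegrable; fun_prop),
      intervalIntegral.integral_const_mul, integral_pow, integral_pow]
    push_cast
    field_simp
    ring

/-- The area of the slice `{b : (a, b) ∈ Ω}` of the ring domain `Ω`, for `‖a‖ = t`. -/
noncomputable def sliceArea (r t : ℝ) : ℝ :=
  π * max (1 - t ^ 2) 0 - π * max ((max r 0) ^ 2 - t ^ 2) 0

theorem Real.sqrt_sq_eq_max (x : ℝ) : √x ^ 2 = max x 0 := by
  rcases le_total 0 x with h | h
  · rw [Real.sq_sqrt h, max_eq_left h]
  · rw [Real.sqrt_eq_zero_of_nonpos h, max_eq_right h]; simp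

/-- With s > 0 the point is nonzero, so r may be replaced by max r 0; this admits negative r, where
the domain is the full ball. The square root is 0 at negative arguments, so the slice becomes a
punctured disc once ‖a‖ exceeds max r 0. -/
theorem pointC2_mem_ringDomain_iff {r s : ℝ} {a : ℂ} (hs : 0 < s) :
    pointC2 a s ∈ ringDomain 2 r ↔ s ∈ Ioo √((max r 0) ^ 2 - ‖a‖ ^ 2) √(1 - ‖a‖ ^ 2) := by
  have hn : ‖pointC2 a s‖ ^ 2 = ‖a‖ ^ 2 + s ^ 2 := by
    rw [norm_sq_pointC2, Complex.norm_real, Real.norm_of_nonneg hs.le]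
  have hpos : 0 < ‖pointC2 a s‖ := by
    refine lt_of_pow_lt_pow_left₀ 2 (norm_nonneg _) ?_
    rw [hn, zero_pow two_ne_zero]; positivity
  have h1 : r < ‖pointC2 a s‖ ↔ max r 0 < ‖pointC2 a s‖ := by simp [hpos]
  rw [mem_Ioo, Real.sqrt_lt' hs, Real.lt_sqrt hs.le]
  change r < ‖pointC2 a s‖ ∧ ‖pointC2 a s‖ < 1 ↔ _
  rw [h1, ← sq_lt_sq₀ (le_max_right r 0) hpos.le, hn, ← sq_lt_one_iff₀ hpos.le, hn]
  constructor <;> rintro ⟨h, h'⟩ <;> constructor <;> linarith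

theorem integral_slice_eq_sliceArea {r : ℝ} (hr : r < 7 / 10) (t : ℝ) :
    ∫ s in Ioi (0 : ℝ), (Ioo √((max r 0) ^ 2 - t ^ 2) √(1 - t ^ 2)).indicator
      (fun s => 2 * π * s) s = sliceArea r t := by
  have hq : (max r 0) ^ 2 ≤ 1 := by
    refine pow_le_one₀ (le_max_right _ _) (max_le (by linarith) (by norm_num))
  rw [integral_ring_radii (Real.sqrt_nonneg _) (Real.sqrt_le_sqrt (by linarith)),
    Real.sqrt_sq_eq_max, Real.sqrt_sq_eq_max, sliceArea]
  ring

/-- The square of the norm of the monomial `z₁ᵏ` in `L²_h` of the ring domain. -/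
noncomputable def monomialNormSq (r : ℝ) (k : ℕ) : ℝ :=
  π ^ 2 * (1 - (max r 0) ^ (2 * (k + 2))) / ((k + 1) * (k + 2))

theorem integral_sliceArea (r : ℝ) (k : ℕ) :
    ∫ t in Ioi (0 : ℝ), 2 * π * t * t ^ (2 * k) * sliceArea r t = monomialNormSq r k := by
  have h1 := integral_pow_mul_max (zero_le_one) k
  have h2 := integral_pow_mul_max (le_max_right r 0) k
  simp only [sliceArea, mul_sub]
  rw [one_pow] at h1
  rw [integral_sub h1.1 h2.1, h1.2, h2.2, monomialNormSq]
  ring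

theorem lebesgueCn_ringDomain_lt_top (n : ℕ) (r : ℝ) : lebesgueCn n (ringDomain n r) < ⊤ :=
  (measure_mono (fun z hz => by simpa using hz.2)).trans_lt
    (measure_ball_lt_top (μ := lebesgueCn n) (x := 0) (r := 1))

/-- Integrating first over the second coordinate replaces f on each slice by its circular mean, the
extension at (a, 0), times the slice area. Circular means in a then keep only the k-th Taylor
coefficient. -/
theorem integral_mul_conj_monomial {r : ℝ} (hr : r < 7 / 10) {f : Cn 2 → ℂ}
    (hf : DifferentiableOn ℂ f (ringDomain 2 r))
    {c : ℕ → ℂ} {k : ℕ}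
    (hc : ∀ s : ℝ, 0 < s → s < 1 →
      Real.circleAverage (fun z => conj z ^ k * hartogsSlice f z) 0 s = (s : ℂ) ^ (2 * k) * c k)
    (hik : IntegrableOn (fun z : Cn 2 => f z * conj (z 0) ^ k) (ringDomain 2 r) (lebesgueCn 2)) :
    ∫ z in ringDomain 2 r, f z * conj (z 0) ^ k ∂(lebesgueCn 2) = monomialNormSq r k * c k := by
  set Ω := ringDomain 2 r
  have hΩ : MeasurableSet Ω := (isOpen_ringDomain 2 r).measurableSet
  set F : Cn 2 → ℂ := Ω.indicator fun z => f z * conj (z 0) ^ k with hF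
  have hFi : Integrable F (lebesgueCn 2) := (integrable_indicator_iff hΩ).2 hik
  have hPi : Integrable (fun p : ℂ × ℂ => F (pointC2 p.1 p.2)) (volume.prod volume) :=
    measurePreserving_pointC2.integrable_comp_of_integrable hFi
  rw [← integral_indicator hΩ, ← measurePreserving_pointC2.integral_comp
    measurableEmbedding_pointC2, Measure.volume_eq_prod, integral_prod _ hPi]
  have havg : ∀ (a : ℂ) (s : ℝ), 0 < s → Real.circleAverage (fun w => F (pointC2 a w)) 0 s =
      (Ioo √((max r 0) ^ 2 - ‖a‖ ^ 2) √(1 - ‖a‖ ^ 2)).indicator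
        (fun _ => conj a ^ k * hartogsSlice f a) s := by
    intro a s hs
    have hmem : ∀ w : ℂ, ‖w‖ = s → (pointC2 a w ∈ Ω ↔ pointC2 a s ∈ Ω) := fun w hw => by
      have : ‖pointC2 a w‖ = ‖pointC2 a s‖ := by
        rw [← sq_eq_sq₀ (norm_nonneg _) (norm_nonneg _), norm_sq_pointC2, norm_sq_pointC2,
          Complex.norm_real, Real.norm_of_nonneg hs.le, hw]
      simp only [Ω, ringDomain, mem_ofPred_eq, this]
    by_cases h : pointC2 a s ∈ Ω
    · rw [indicator_of_mem ((pointC2_mem_ringDomain_iff hs).1 h),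
        ← circleAverage_eq_hartogsSlice hr hf hs h, ← smul_eq_mul, ← Real.circleAverage_fun_smul]
      refine Real.circleAverage_congr_sphere fun w hw => ?_
      have hw' : ‖w‖ = s := by simpa [abs_of_pos hs] using hw
      simp only [hF, indicator_of_mem ((hmem w hw').2 h), smul_eq_mul]
      rw [mul_comm]
      simp [pointC2]
    · rw [indicator_of_notMem (fun h' => h ((pointC2_mem_ringDomain_iff hs).2 h'))]
      refine (Real.circleAverage_congr_sphere (f₂ := fun _ => (0 : ℂ)) fun w hw => ?_).trans
        (Real.circleAverage_const 0 0 s)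
      have hw' : ‖w‖ = s := by simpa [abs_of_pos hs] using hw
      simp only [hF, indicator_of_notMem (fun h' => h ((hmem w hw').1 h'))]
  have hslice : ∀ᵐ a : ℂ, ∫ b, F (pointC2 a b) =
      sliceArea r ‖a‖ • (conj a ^ k * hartogsSlice f a) := by
    filter_upwards [hPi.prod_right_ae] with a ha
    rw [Complex.integral_eq_integral_circleAverage ha, ← integral_slice_eq_sliceArea hr,
      ← integral_smul_const]
    refine setIntegral_congr_fun measurableSet_Ioi fun s hs => ?_
    simp only [havg a s hs]
    by_cases h : s ∈ Ioo √((max r 0) ^ 2 - ‖a‖ ^ 2) √(1 - ‖a‖ ^ 2)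
    · simp only [indicator_of_mem h]
    · simp only [indicator_of_notMem h, smul_zero, zero_smul]
  have hint : Integrable (fun a : ℂ => sliceArea r ‖a‖ • (conj a ^ k * hartogsSlice f a)) :=
    hPi.integral_prod_left.congr hslice
  rw [integral_congr_ae hslice, Complex.integral_eq_integral_circleAverage hint,
    ← integral_sliceArea, ← integral_complex_ofReal, ← integral_mul_const]
  refine setIntegral_congr_fun measurableSet_Ioi fun t ht => ?_
  have ht0 : 0 < t := ht
  have hcirc : Real.circleAverage
      (fun a : ℂ => sliceArea r ‖a‖ • (conj a ^ k * hartogsSlice f a)) 0 t =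
      sliceArea r t • Real.circleAverage (fun z => conj z ^ k * hartogsSlice f z) 0 t := by
    rw [← Real.circleAverage_fun_smul]
    refine Real.circleAverage_congr_sphere fun w hw => ?_
    have hw' : ‖w‖ = t := by simpa [abs_of_pos ht0] using hw
    simp only [hw']
  simp only [hcirc]
  rcases lt_or_ge t 1 with h1 | h1
  · rw [hc t ht0 h1]
    simp only [Complex.real_smul]
    push_cast
    ring
  -- Beyond the ball the formula for the circular means is unavailable, but the slice is empty.
  · have hz : sliceArea r t = 0 := by
      have hq : (max r 0) ^ 2 ≤ 1 :=
        pow_le_one₀ (le_max_right _ _) (max_le (by linarith) (by norm_num))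
      have : 1 ≤ t ^ 2 := one_le_pow₀ h1
      rw [sliceArea, max_eq_right (by linarith), max_eq_right (by linarith)]
      simp
    simp [hz]

theorem IsBergmanFunction.integrableOn {n : ℕ} {r : ℝ} {f : Cn n → ℂ}
    (hf : IsBergmanFunction (ringDomain n r) f) :
    IntegrableOn f (ringDomain n r) (lebesgueCn n) := by
  have : IsFiniteMeasure ((lebesgueCn n).restrict (ringDomain n r)) :=
    ⟨by simpa using lebesgueCn_ringDomain_lt_top n r⟩
  exact hf.2.integrable one_le_two

/-! ### The Bergman kernel of the ring domain -/

/-- The coefficients of the Bergman kernel of the ring domain as a power series in `⟨z, w⟩`. -/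
noncomputable def kernelCoeff (r : ℝ) (k : ℕ) : ℝ := (monomialNormSq r k)⁻¹

theorem max_pow_le_half {r : ℝ} (hr : r < 7 / 10) (k : ℕ) : (max r 0) ^ (2 * (k + 2)) ≤ 1 / 2 := by
  have h0 : 0 ≤ max r 0 := le_max_right _ _
  have h1 : max r 0 ≤ 7 / 10 := max_le hr.le (by norm_num)
  calc (max r 0) ^ (2 * (k + 2)) ≤ (max r 0) ^ 2 :=
        pow_le_pow_of_le_one h0 (by linarith) (by omega)
    _ ≤ (7 / 10) ^ 2 := by gcongr
    _ ≤ 1 / 2 := by norm_num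

theorem monomialNormSq_pos {r : ℝ} (hr : r < 7 / 10) (k : ℕ) : 0 < monomialNormSq r k := by
  have := max_pow_le_half hr k
  unfold monomialNormSq
  have : 0 < 1 - (max r 0) ^ (2 * (k + 2)) := by linarith
  positivity

theorem kernelCoeff_pos {r : ℝ} (hr : r < 7 / 10) (k : ℕ) : 0 < kernelCoeff r k := inv_pos.2 (monomialNormSq_pos hr k)

theorem polyBounded_kernelCoeff {r : ℝ} (hr : r < 7 / 10) : PolyBounded (kernelCoeff r) := by
  -- From (k+1)(k+2) ≤ 2(k+1)² and 1 - (max r 0)^(2(k+2)) ≥ 1/2.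
  refine ⟨4 / π ^ 2, 2, fun k => ?_⟩
  rw [abs_of_pos (kernelCoeff_pos hr k), kernelCoeff, monomialNormSq, inv_div]
  have := max_pow_le_half hr k
  have hk : (0 : ℝ) ≤ k := k.cast_nonneg
  have hpi := Real.pi_pos
  rw [div_mul_eq_mul_div, div_le_div_iff₀ (mul_pos (by positivity) (by linarith)) (by positivity)]
  have h1 : ((k : ℝ) + 1) * (k + 2) ≤ 2 * (k + 1) ^ 2 := by nlinarith
  have h2 : 2 * ((k : ℝ) + 1) ^ 2 ≤ 4 * (k + 1) ^ 2 * (1 - (max r 0) ^ (2 * (k + 2))) := by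
    nlinarith [sq_nonneg ((k : ℝ) + 1)]
  nlinarith [sq_nonneg π, mul_le_mul_of_nonneg_right (h1.trans h2) (sq_nonneg π)]

theorem norm_powerSum_kernelCoeff_le {r : ℝ} (hr : r < 7 / 10) {s : ℂ} {R : ℝ} (hs : ‖s‖ ≤ R) (hR : R < 1) :
    ‖powerSum (kernelCoeff r) s‖ ≤ ∑' k, kernelCoeff r k * R ^ k := by
  have hp := polyBounded_kernelCoeff hr
  have hsum := hp.norm_summable (hs.trans_lt hR)
  refine (norm_tsum_le_tsum_norm hsum).trans (hsum.tsum_le_tsum (fun k => ?_) ?_)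
  · rw [norm_mul, norm_pow, RCLike.norm_ofReal, abs_of_pos (kernelCoeff_pos hr k)]
    have := (kernelCoeff_pos hr k).le
    gcongr
  · refine (hp.summable ((norm_nonneg s).trans hs) hR).congr fun k => ?_
    rw [abs_of_pos (kernelCoeff_pos hr k)]

/-- Each term of the kernel series integrates to cₖρᵏ, since its coefficient inverts the squared
norm; the sum is the Taylor series of the extended slice at ρ. Sum and integral commute because ‖z₁‖
≤ 1 and the coefficients times ρᵏ are summable. -/
theorem integral_mul_conj_kernel_axis {r : ℝ} (hr : r < 7 / 10) {f : Cn 2 → ℂ}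
    (hf : IsBergmanFunction (ringDomain 2 r) f) {ρ : ℝ}
    (h0 : 0 ≤ ρ) (hρr : r < ρ) (h1 : ρ < 1) :
    f (pointC2 ρ 0) = ∫ z in ringDomain 2 r,
      f z * conj (powerSum (kernelCoeff r) ((ρ : ℂ) * z 0)) ∂(lebesgueCn 2) := by
  set Ω := ringDomain 2 r
  have hΩ : MeasurableSet Ω := (isOpen_ringDomain 2 r).measurableSet
  obtain ⟨c, hc, hcirc⟩ := exists_taylor_circleAverage (differentiableOn_hartogsSlice hr hf.1)
  have hfi := hf.integrableOn
  have hz0 : ∀ z ∈ Ω, ‖z 0‖ ≤ 1 := fun z hz =>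
    (PiLp.norm_apply_le z 0).trans hz.2.le
  have hz0c : Continuous fun z : Cn 2 => z 0 := by fun_prop
  have hmono : ∀ k : ℕ, IntegrableOn (fun z : Cn 2 => f z * conj (z 0) ^ k) Ω (lebesgueCn 2) := by
    intro k
    refine Integrable.mul_bdd (c := 1) hfi ?_ ?_
    · exact Continuous.aestronglyMeasurable (by fun_prop)
    · filter_upwards [ae_restrict_mem hΩ] with z hz
      rw [norm_pow, RCLike.norm_conj]
      exact pow_le_one₀ (norm_nonneg _) (hz0 z hz)
  have hpb := polyBounded_kernelCoeff hr
  set Φ : ℕ → Cn 2 → ℂ := fun k z => ((kernelCoeff r k * ρ ^ k : ℝ) : ℂ) * (f z * conj (z 0) ^ k)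
  have hΦi : ∀ k, Integrable (Φ k) ((lebesgueCn 2).restrict Ω) := fun k => (hmono k).const_mul _
  have hΦs : Summable fun k => ∫ z in Ω, ‖Φ k z‖ ∂(lebesgueCn 2) := by
    refine Summable.of_nonneg_of_le (fun k => integral_nonneg fun z => norm_nonneg _)
      (fun k => ?_) ((hpb.summable h0 h1).mul_right (∫ z in Ω, ‖f z‖ ∂(lebesgueCn 2)))
    rw [← integral_const_mul]
    refine integral_mono_ae (hΦi k).norm (hfi.norm.const_mul _) ?_
    filter_upwards [ae_restrict_mem hΩ] with z hz
    simp only [Φ, norm_mul, norm_pow, RCLike.norm_conj, Complex.norm_real, Real.norm_eq_abs,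
      abs_of_nonneg h0]
    have : ‖z 0‖ ^ k ≤ 1 := pow_le_one₀ (norm_nonneg _) (hz0 z hz)
    calc |kernelCoeff r k| * ρ ^ k * (‖f z‖ * ‖z 0‖ ^ k)
        ≤ |kernelCoeff r k| * ρ ^ k * (‖f z‖ * 1) := by gcongr
      _ = _ := by ring
  have hsum := hasSum_integral_of_summable_integral_norm hΦi hΦs
  have hval : ∀ k, ∫ z in Ω, Φ k z ∂(lebesgueCn 2) = c k * (ρ : ℂ) ^ k := by
    intro k
    simp only [Φ]
    rw [integral_const_mul, integral_mul_conj_monomial hr hf.1 (fun s => hcirc k s) (hmono k)]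
    have : (monomialNormSq r k : ℂ) ≠ 0 := by exact_mod_cast (monomialNormSq_pos hr k).ne'
    rw [kernelCoeff]
    push_cast
    field_simp
  simp only [hval] at hsum
  have hρn : ‖(ρ : ℂ)‖ = ρ := by rw [Complex.norm_real, Real.norm_of_nonneg h0]
  rw [← hartogsSlice_eq hf.1 (by rwa [hρn]), (hc ρ (by rwa [hρn])).unique hsum]
  refine setIntegral_congr_fun hΩ fun z hz => ?_
  simp only [Φ]
  have hn : ‖(ρ : ℂ) * z 0‖ < 1 := by
    rw [norm_mul, hρn]
    exact (mul_le_of_le_one_right h0 (hz0 z hz)).trans_lt h1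
  rw [powerSum, Complex.conj_tsum, ← tsum_mul_left]
  refine tsum_congr fun k => ?_
  simp
  ring

/-- Some unitary map of `ℂ²` takes `(‖w‖, 0)` to `w`. -/
theorem exists_unitary_pointC2 (w : Cn 2) :
    ∃ V : Cn 2 ≃ₗᵢ[ℂ] Cn 2, V (pointC2 (‖w‖ : ℂ) 0) = w := by
  rcases eq_or_ne w 0 with rfl | hw
  · refine ⟨LinearIsometryEquiv.refl ℂ _, ?_⟩
    ext i
    fin_cases i <;> simp [pointC2]
  have hw0 : (‖w‖ : ℂ) ≠ 0 := by simpa using hw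
  set u : Cn 2 := (‖w‖ : ℂ)⁻¹ • w with hu
  have hun : ‖u 0‖ ^ 2 + ‖u 1‖ ^ 2 = 1 := by
    rw [← norm_sq_pointC2, pointC2_eta, hu, norm_smul, norm_inv, Complex.norm_real, norm_norm,
      inv_mul_cancel₀ (norm_ne_zero_iff.2 hw), one_pow]
  -- The unitary matrix with columns u and (-conj u₁, conj u₀), for the unit vector u = w/‖w‖.
  let T : Cn 2 →ₗ[ℂ] Cn 2 :=
    { toFun := fun z => pointC2 (z 0 * u 0 - z 1 * conj (u 1)) (z 0 * u 1 + z 1 * conj (u 0))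
      map_add' := fun x y => by
        ext i
        fin_cases i <;> simp [pointC2] <;> ring
      map_smul' := fun a x => by
        ext i
        fin_cases i <;> simp [pointC2] <;> ring }
  have hT : ∀ z, ‖T z‖ = ‖z‖ := fun z => by
    rw [← sq_eq_sq₀ (norm_nonneg _) (norm_nonneg _)]
    change ‖pointC2 _ _‖ ^ 2 = _
    rw [norm_sq_pointC2, ← pointC2_eta z, norm_sq_pointC2]
    simp only [pointC2_eta]
    simp only [Complex.sq_norm, Complex.normSq_apply] at hun ⊢
    simp only [Complex.add_re, Complex.add_im, Complex.sub_re, Complex.sub_im, Complex.mul_re,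
      Complex.mul_im, Complex.conj_re, Complex.conj_im]
    linear_combination ((z 0).re * (z 0).re + (z 0).im * (z 0).im +
      ((z 1).re * (z 1).re + (z 1).im * (z 1).im)) * hun
  refine ⟨LinearIsometry.toLinearIsometryEquiv ⟨T, hT⟩ rfl, ?_⟩
  rw [LinearIsometry.toLinearIsometryEquiv_apply]
  change pointC2 _ _ = w
  ext i
  fin_cases i <;> simp [pointC2, hu, hw0]

theorem preimage_ringDomain {n : ℕ} (r : ℝ) (V : Cn n ≃ₗᵢ[ℂ] Cn n) :
    V ⁻¹' ringDomain n r = ringDomain n r := by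
  ext z
  simp [ringDomain]

theorem IsBergmanFunction.comp_unitary {n : ℕ} {r : ℝ} {f : Cn n → ℂ}
    (hf : IsBergmanFunction (ringDomain n r) f) (V : Cn n ≃ₗᵢ[ℂ] Cn n) :
    IsBergmanFunction (ringDomain n r) (f ∘ V) := by
  refine ⟨hf.1.comp V.toContinuousLinearEquiv.differentiable.differentiableOn fun z hz => ?_, ?_⟩
  · rw [← preimage_ringDomain r V] at hz
    exact hz
  · have := (V.measurePreserving_addHaar (lebesgueCn n)).restrict_preimage
      (isOpen_ringDomain n r).measurableSet
    rw [preimage_ringDomain] at this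
    exact hf.2.comp_measurePreserving this

/-- A unitary V taking (‖w‖, 0) to w preserves the domain and the measure, and ⟨w, Vz⟩ = ‖w‖ z₁;
this reduces to the axis. The inner product is linear in its second argument, hence holomorphic in
z. -/
theorem isReproducingAt_ringDomain {r : ℝ} (hr : r < 7 / 10) {w : Cn 2}
    (hw : w ∈ ringDomain 2 r) :
    IsReproducingAt (ringDomain 2 r) w fun z => powerSum (kernelCoeff r) (inner ℂ w z) := by
  have hΩ : MeasurableSet (ringDomain 2 r) := (isOpen_ringDomain 2 r).measurableSet
  have hle : ∀ z ∈ ringDomain 2 r, ‖inner ℂ w z‖ ≤ ‖w‖ := fun z hz =>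
    (norm_inner_le_norm w z).trans (mul_le_of_le_one_right (norm_nonneg _) hz.2.le)
  have hd : DifferentiableOn ℂ (fun z => powerSum (kernelCoeff r) (inner ℂ w z))
      (ringDomain 2 r) := fun z hz => by
    refine DifferentiableAt.differentiableWithinAt ?_
    exact DifferentiableAt.comp z ((polyBounded_kernelCoeff hr).hasDerivAt
      ((hle z hz).trans_lt hw.2)).differentiableAt (innerSL ℂ w).differentiableAt
  refine ⟨⟨hd, ?_⟩, fun f hf => ?_⟩
  · have : IsFiniteMeasure ((lebesgueCn 2).restrict (ringDomain 2 r)) :=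
      ⟨by simpa using lebesgueCn_ringDomain_lt_top 2 r⟩
    refine MemLp.of_bound (hd.continuousOn.aestronglyMeasurable hΩ)
      (∑' k, kernelCoeff r k * ‖w‖ ^ k) ?_
    filter_upwards [ae_restrict_mem hΩ] with z hz
    exact norm_powerSum_kernelCoeff_le hr (hle z hz) hw.2
  · obtain ⟨V, hV⟩ := exists_unitary_pointC2 w
    have h := integral_mul_conj_kernel_axis hr (hf.comp_unitary V) (norm_nonneg w) hw.1 hw.2
    rw [Function.comp_apply, hV] at h
    have hint := (V.measurePreserving_addHaar (lebesgueCn 2)).setIntegral_preimage_emb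
      V.toHomeomorph.measurableEmbedding
      (fun z => f z * conj (powerSum (kernelCoeff r) (inner ℂ w z))) (ringDomain 2 r)
    rw [h, ← hint, preimage_ringDomain]
    refine setIntegral_congr_fun hΩ fun z _ => ?_
    have : inner ℂ w (V z) = (‖w‖ : ℂ) * z 0 := by
      nth_rewrite 1 [← hV]
      rw [V.inner_map_map, PiLp.inner_apply]
      simp [pointC2, mul_comm]
    simp only [Function.comp_apply, this]

/-- Here k(w) = ‖k‖² is real, while k(w) = ⟨k, k'⟩ and k'(w) = ⟨k', k⟩ are conjugate. So the choice
made in `bergmanKernel` does not affect the diagonal. -/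
theorem IsReproducingAt.apply_eq {n : ℕ} {Ω : Set (Cn n)} {w : Cn n} {k k' : Cn n → ℂ}
    (h : IsReproducingAt Ω w k) (h' : IsReproducingAt Ω w k') : k w = k' w := by
  have hself : conj (k w) = k w := by
    have := h.2 k h.1
    rw [this, ← integral_conj]
    simp [mul_comm]
  rw [← hself, h'.2 k h.1, h.2 k' h'.1, ← integral_conj]
  simp [mul_comm]

theorem bergmanKernel_diag {n : ℕ} {Ω : Set (Cn n)} {w : Cn n} {k : Cn n → ℂ}
    (h : IsReproducingAt Ω w k) : bergmanKernel Ω w w = k w := by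
  have hex : ∃ k : Cn n → ℂ, IsReproducingAt Ω w k := ⟨k, h⟩
  rw [bergmanKernel, dif_pos hex]
  exact hex.choose_spec.apply_eq h

theorem bergmanKernel_ringDomain_diag {r : ℝ} (hr : r < 7 / 10) {w : Cn 2}
    (hw : w ∈ ringDomain 2 r) :
    (bergmanKernel (ringDomain 2 r) w w).re = powerSum (kernelCoeff r) (‖w‖ ^ 2 : ℝ) := by
  rw [bergmanKernel_diag (isReproducingAt_ringDomain hr hw), inner_self_eq_norm_sq_to_K]
  rw [← Complex.ofReal_re (powerSum (kernelCoeff r) (‖w‖ ^ 2 : ℝ)), powerSum, powerSum,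
    Complex.ofReal_tsum]
  simp

theorem powerSum_kernelCoeff_pos {r : ℝ} (hr : r < 7 / 10) {t : ℝ} (h0 : 0 ≤ t) (h1 : t < 1) :
    0 < powerSum (kernelCoeff r) t := by
  have hs : Summable fun k => kernelCoeff r k * t ^ k := by
    refine ((polyBounded_kernelCoeff hr).summable h0 h1).congr fun k => ?_
    rw [abs_of_pos (kernelCoeff_pos hr k)]
  exact hs.tsum_pos (fun k => mul_nonneg (kernelCoeff_pos hr k).le (pow_nonneg h0 k)) 0
    (by simpa using kernelCoeff_pos hr 0)

theorem contDiffOn_log_powerSum {r : ℝ} (hr : r < 7 / 10) :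
    ContDiffOn ℝ 2 (fun z : Cn 2 => Real.log (powerSum (kernelCoeff r) (‖z‖ ^ 2)))
      {z | ‖z‖ < 1} := by
  have h1 : ContDiffOn ℝ 2 (fun z : Cn 2 => powerSum (kernelCoeff r) (‖z‖ ^ 2)) {z | ‖z‖ < 1} := by
    have := (polyBounded_kernelCoeff hr).contDiffOn 2
    refine ContDiffOn.comp (t := Ioo (-1) 1) (g := powerSum (kernelCoeff r))
      (f := fun z : Cn 2 => ‖z‖ ^ 2) (by exact_mod_cast this)
      (contDiff_norm_sq ℂ).contDiffOn fun z hz => ?_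
    exact ⟨by linarith [sq_nonneg ‖z‖], (sq_lt_one_iff₀ (norm_nonneg _)).2 hz⟩
  exact h1.log fun z hz => (powerSum_kernelCoeff_pos hr (sq_nonneg _)
    ((sq_lt_one_iff₀ (norm_nonneg _)).2 hz)).ne'

theorem logBergmanDiag_ringDomain {r : ℝ} (hr : r < 7 / 10) {z : Cn 2}
    (hz : z ∈ ringDomain 2 r) :
    logBergmanDiag (ringDomain 2 r) z = Real.log (powerSum (kernelCoeff r) (‖z‖ ^ 2)) := by
  rw [logBergmanDiag, bergmanKernel_ringDomain_diag hr hz]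

theorem bergmanMetricDefined_ringDomain {r : ℝ} (hr : r < 7 / 10) :
    BergmanMetricDefined (ringDomain 2 r) := by
  refine ⟨fun w hw => ⟨_, isReproducingAt_ringDomain hr hw⟩, fun z hz => ?_, ?_⟩
  · rw [bergmanKernel_ringDomain_diag hr hz]
    exact powerSum_kernelCoeff_pos hr (sq_nonneg _) ((sq_lt_one_iff₀ (norm_nonneg _)).2 hz.2)
  · exact ((contDiffOn_log_powerSum hr).mono fun z hz => hz.2).congr fun z hz =>
      logBergmanDiag_ringDomain hr hz

/-- A negative radius is needed: radius 0 would remove the origin. -/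
theorem unitBallCn_eq_ringDomain (n : ℕ) : unitBallCn n = ringDomain n (-1) := by
  ext z
  simp only [unitBallCn, ringDomain, mem_ofPred_eq]
  exact ⟨fun h => ⟨by linarith [norm_nonneg z], h⟩, fun h => h.2⟩

/-! ### The Levi form of a radial function -/

section Levi

variable {n : ℕ}

theorem differentiableAt_norm_sq_Cn (z : Cn n) : DifferentiableAt ℝ (fun z : Cn n => ‖z‖ ^ 2) z :=
  (contDiff_norm_sq ℂ (n := 1)).differentiable (by norm_num) z

theorem fderiv_norm_sq_Cn (z v : Cn n) :
    fderiv ℝ (fun z : Cn n => ‖z‖ ^ 2) z v = 2 * (inner ℂ z v).re := by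
  rw [← (differentiableAt_norm_sq_Cn z).lineDeriv_eq_fderiv]
  refine HasDerivAt.deriv ?_
  have heq : (fun t : ℝ => ‖z + t • v‖ ^ 2) =
      fun t : ℝ => ‖z‖ ^ 2 + 2 * (t * (inner ℂ z v).re) + t ^ 2 * ‖v‖ ^ 2 := by
    funext t
    rw [norm_add_sq (𝕜 := ℂ), norm_smul, mul_pow, Real.norm_eq_abs, sq_abs]
    congr 3
    rw [← Complex.coe_smul, inner_smul_right]
    simp
  rw [heq]
  have h1 := (((hasDerivAt_id (0 : ℝ)).mul_const (inner ℂ z v).re).const_mul 2).const_add (‖z‖ ^ 2)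
  have h2 := ((hasDerivAt_id (0 : ℝ)).fun_pow 2).mul_const (‖v‖ ^ 2)
  simpa using h1.fun_add h2

theorem inner_single_Cn (z : Cn n) (ν : Fin n) (c : ℂ) :
    inner ℂ z (EuclideanSpace.single ν c) = c * conj (z ν) :=
  EuclideanSpace.inner_single_right ν c z

theorem wirtingerBar_radial {ψ : ℝ → ℝ} {ψ' : ℝ} {z : Cn n} (h : HasDerivAt ψ ψ' (‖z‖ ^ 2))
    (μ : Fin n) :
    wirtingerBar μ (fun z => ((ψ (‖z‖ ^ 2) : ℝ) : ℂ)) z = ψ' * z μ := by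
  have h1 : HasFDerivAt (fun z : Cn n => ψ (‖z‖ ^ 2)) _ z :=
    h.comp_hasFDerivAt z (differentiableAt_norm_sq_Cn z).hasFDerivAt
  have h2 := (Complex.ofRealCLM.hasFDerivAt (x := ψ (‖z‖ ^ 2))).comp z h1
  have h3 : fderiv ℝ (fun z : Cn n => ((ψ (‖z‖ ^ 2) : ℝ) : ℂ)) z = _ := h2.fderiv
  rw [wirtingerBar, h3]
  simp only [ContinuousLinearMap.comp_apply, _root_.smul_apply, fderiv_norm_sq_Cn,
    inner_single_Cn, Complex.ofRealCLM_apply]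
  apply Complex.ext <;> simp <;> ring

theorem wirtinger_radial_mul {φ : ℝ → ℝ} {φ' : ℝ} {p : Cn n} (h : HasDerivAt φ φ' (‖p‖ ^ 2))
    (ν μ : Fin n) :
    wirtinger ν (fun z => ((φ (‖z‖ ^ 2) : ℝ) : ℂ) * z μ) p =
      φ' * conj (p ν) * p μ + φ (‖p‖ ^ 2) * (if ν = μ then 1 else 0) := by
  have h1 : HasFDerivAt (fun z : Cn n => φ (‖z‖ ^ 2)) _ p :=
    h.comp_hasFDerivAt p (differentiableAt_norm_sq_Cn p).hasFDerivAt
  have h2 := (Complex.ofRealCLM.hasFDerivAt (x := φ (‖p‖ ^ 2))).comp p h1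
  have hproj : HasFDerivAt (fun z : Cn n => z μ)
      ((EuclideanSpace.proj μ : Cn n →L[ℂ] ℂ).restrictScalars ℝ) p :=
    ((EuclideanSpace.proj μ : Cn n →L[ℂ] ℂ).restrictScalars ℝ).hasFDerivAt
  have h3 : fderiv ℝ (fun z : Cn n => ((φ (‖z‖ ^ 2) : ℝ) : ℂ) * z μ) p = _ := (h2.mul hproj).fderiv
  have hpr : ∀ c : ℂ, (EuclideanSpace.proj μ : Cn n →L[ℂ] ℂ) (EuclideanSpace.single ν c) =
      if ν = μ then c else 0 := fun c => by
    simp [eq_comm]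
  rw [wirtinger, h3]
  simp only [_root_.add_apply, ContinuousLinearMap.comp_apply,
    _root_.smul_apply, fderiv_norm_sq_Cn,
    inner_single_Cn, Complex.ofRealCLM_apply, ContinuousLinearMap.coe_restrictScalars',
    hpr, Function.comp_apply, smul_eq_mul]
  by_cases hνμ : ν = μ
  · subst hνμ
    simp only [if_true]
    apply Complex.ext <;> simp <;> ring
  · simp only [if_neg hνμ]
    apply Complex.ext <;> simp <;> ring

end Levi

/-- The complex Hessian is ψ₁δ + ψ₂ conj(p_ν) p_μ; on the unit vector p/‖p‖ the first part gives ψ₁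
and the rank-one part ‖p‖²ψ₂. -/
theorem leviForm_radial {u : Cn 2 → ℝ} {ψ ψ₁ : ℝ → ℝ} {ψ₂ : ℝ} {p : Cn 2} (hp : p ≠ 0)
    (hu : u =ᶠ[𝓝 p] fun z => ψ (‖z‖ ^ 2))
    (h1 : ∀ᶠ t in 𝓝 (‖p‖ ^ 2), HasDerivAt ψ (ψ₁ t) t) (h2 : HasDerivAt ψ₁ ψ₂ (‖p‖ ^ 2)) :
    leviForm u p ((‖p‖ : ℂ)⁻¹ • p) = ψ₁ (‖p‖ ^ 2) + ‖p‖ ^ 2 * ψ₂ := by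
  have hcont : Continuous fun z : Cn 2 => ‖z‖ ^ 2 := by fun_prop
  have hbar : ∀ μ : Fin 2, wirtingerBar μ (fun z => ((u z : ℝ) : ℂ)) =ᶠ[𝓝 p]
      fun z => ((ψ₁ (‖z‖ ^ 2) : ℝ) : ℂ) * z μ := fun μ => by
    filter_upwards [hu.eventually_nhds, hcont.continuousAt.eventually h1] with z hz hz1
    rw [← wirtingerBar_radial hz1 μ]
    have : (fun z => ((u z : ℝ) : ℂ)) =ᶠ[𝓝 z] fun z => ((ψ (‖z‖ ^ 2) : ℝ) : ℂ) := by
      filter_upwards [hz] with y hy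
      rw [hy]
    simp only [wirtingerBar, this.fderiv_eq]
  have hw : ∀ ν μ : Fin 2, wirtinger ν (wirtingerBar μ (fun z => ((u z : ℝ) : ℂ))) p =
      ψ₂ * conj (p ν) * p μ + ψ₁ (‖p‖ ^ 2) * (if ν = μ then 1 else 0) := fun ν μ => by
    rw [← wirtinger_radial_mul h2]
    simp only [wirtinger, (hbar μ).fderiv_eq]
  have hn : p 0 * conj (p 0) + p 1 * conj (p 1) = (‖p‖ : ℂ) ^ 2 := by
    rw [Complex.mul_conj', Complex.mul_conj']
    have := norm_sq_pointC2 (p 0) (p 1)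
    rw [pointC2_eta] at this
    rw [← Complex.ofReal_pow ‖p‖, this]
    push_cast
    rfl
  have hp0 : (‖p‖ : ℂ) ≠ 0 := by simpa using hp
  have key : (∑ ν : Fin 2, ∑ μ : Fin 2,
      wirtinger ν (wirtingerBar μ (fun z => ((u z : ℝ) : ℂ))) p *
        ((‖p‖ : ℂ)⁻¹ • p) ν * conj (((‖p‖ : ℂ)⁻¹ • p) μ)) =
      ((ψ₁ (‖p‖ ^ 2) + ‖p‖ ^ 2 * ψ₂ : ℝ) : ℂ) := by
    simp only [hw, Fin.sum_univ_two, PiLp.smul_apply, smul_eq_mul, map_mul, map_inv₀,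
      Complex.conj_ofReal]
    simp only [if_true, zero_ne_one, one_ne_zero, if_false]
    push_cast
    field_simp
    linear_combination (ψ₂ * (p 0 * conj (p 0) + p 1 * conj (p 1) + (‖p‖ : ℂ) ^ 2) +
      ψ₁ (‖p‖ ^ 2)) * hn
  rw [leviForm, key, Complex.ofReal_re]

/-- The Levi form of `log (∑ aₖ |z|²ᵏ)` in the direction `z / |z|`, for `|z|² = t`. -/
noncomputable def radialLevi (a : ℕ → ℝ) (t : ℝ) : ℝ :=
  powerSum (derivCoeff a) t / powerSum a t +
    t * ((powerSum (derivCoeff (derivCoeff a)) t * powerSum a t -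
      powerSum (derivCoeff a) t * powerSum (derivCoeff a) t) / powerSum a t ^ 2)

theorem leviForm_ringDomain {r : ℝ} (hr : r < 7 / 10) {z : Cn 2} (hz : z ∈ ringDomain 2 r)
    (hz0 : z ≠ 0) :
    leviForm (logBergmanDiag (ringDomain 2 r)) z ((‖z‖ : ℂ)⁻¹ • z) =
      radialLevi (kernelCoeff r) (‖z‖ ^ 2) := by
  have hpb := polyBounded_kernelCoeff hr
  have hpos : 0 < ‖z‖ ^ 2 := by positivity
  have hlt : ‖z‖ ^ 2 < 1 := (sq_lt_one_iff₀ (norm_nonneg _)).2 hz.2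
  have hnorm : ∀ t ∈ Ioo (0 : ℝ) 1, ‖t‖ < 1 := fun t ht => by
    rw [Real.norm_of_nonneg ht.1.le]; exact ht.2
  refine leviForm_radial (ψ := fun t => Real.log (powerSum (kernelCoeff r) t))
    (ψ₁ := fun t => powerSum (derivCoeff (kernelCoeff r)) t / powerSum (kernelCoeff r) t)
    hz0 ?_ ?_ ?_
  · filter_upwards [(isOpen_ringDomain 2 r).mem_nhds hz] with y hy
    exact logBergmanDiag_ringDomain hr hy
  · filter_upwards [isOpen_Ioo.mem_nhds ⟨hpos, hlt⟩] with t ht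
    exact (hpb.hasDerivAt (hnorm t ht)).log (powerSum_kernelCoeff_pos hr ht.1.le ht.2).ne'
  · have ht := hnorm _ ⟨hpos, hlt⟩
    exact (hpb.derivCoeff.hasDerivAt ht).div (hpb.hasDerivAt ht)
      (powerSum_kernelCoeff_pos hr hpos.le hlt).ne'

/-! ### Comparison of the ring domain with the ball -/

/-- The coefficients of `2 / (1 - t)³`. -/
def ballCoeff (k : ℕ) : ℝ := ((k : ℝ) + 1) * (k + 2)

theorem ballCoeff_eq : ballCoeff = fun k => 2 * ((k + 2).choose 2 : ℝ) := by
  funext k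
  have h := congrArg (Nat.cast (R := ℝ)) (Nat.descFactorial_eq_factorial_mul_choose (k + 2) 2)
  simp [Nat.descFactorial, Nat.factorial] at h
  rw [ballCoeff]
  linarith

theorem derivCoeff_ballCoeff_eq :
    derivCoeff ballCoeff = fun k => 6 * ((k + 3).choose 3 : ℝ) := by
  funext k
  have h := congrArg (Nat.cast (R := ℝ)) (Nat.descFactorial_eq_factorial_mul_choose (k + 3) 3)
  simp [Nat.descFactorial, Nat.factorial] at h
  simp only [derivCoeff, ballCoeff]
  push_cast
  linarith

theorem derivCoeff_derivCoeff_ballCoeff_eq :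
    derivCoeff (derivCoeff ballCoeff) = fun k => 24 * ((k + 4).choose 4 : ℝ) := by
  funext k
  have h := congrArg (Nat.cast (R := ℝ)) (Nat.descFactorial_eq_factorial_mul_choose (k + 4) 4)
  simp [Nat.descFactorial, Nat.factorial] at h
  simp only [derivCoeff, ballCoeff]
  push_cast
  linarith

/-- D₀, D₁, D₂ are the increments of the kernel and of its first two derivatives. After clearing
denominators, the gain of about 6P from D₀ = cP, with P ≥ 2q², beats the O(q³) loss from D₁ and tD₂.
-/
theorem radialLevi_perturbation {c t q D₀ D₁ D₂ : ℝ} (hc : 0 < c) (hq : 0 < q) (hq1 : q < 1 / 100)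
    (ht0 : 0 < t) (ht : t < 4 * q) (hD0 : 2 * q ^ 2 * c ≤ D₀) (hD1 : 0 ≤ D₁)
    (hD1' : D₁ ≤ 24 * q ^ 3 * c) (hD2 : D₂ ≤ 96 * q ^ 4 * c) :
    (c * (6 / (1 - t) ^ 4) + D₁) / (c * (2 / (1 - t) ^ 3) + D₀) +
      t * (((c * (24 / (1 - t) ^ 5) + D₂) * (c * (2 / (1 - t) ^ 3) + D₀) -
        (c * (6 / (1 - t) ^ 4) + D₁) * (c * (6 / (1 - t) ^ 4) + D₁)) /
          (c * (2 / (1 - t) ^ 3) + D₀) ^ 2) < 3 / (1 - t) ^ 2 := by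
  have hU : 0 < 1 - t := by linarith
  obtain ⟨u, hu⟩ : ∃ u, u = (1 - t)⁻¹ := ⟨_, rfl⟩
  have hut : u * (1 - t) = 1 := by rw [hu]; field_simp
  obtain ⟨P, rfl⟩ : ∃ P, D₀ = c * P := ⟨D₀ / c, by field_simp⟩
  obtain ⟨P₁, rfl⟩ : ∃ P, D₁ = c * P := ⟨D₁ / c, by field_simp⟩
  obtain ⟨P₂, rfl⟩ : ∃ P, D₂ = c * P := ⟨D₂ / c, by field_simp⟩
  have hP : 2 * q ^ 2 ≤ P := by
    refine le_of_mul_le_mul_left ?_ hc; linarith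
  have hP1 : 0 ≤ P₁ := by
    refine le_of_mul_le_mul_left ?_ hc; linarith
  have hP1' : P₁ ≤ 24 * q ^ 3 := by
    refine le_of_mul_le_mul_left ?_ hc; linarith
  have hP2 : P₂ ≤ 96 * q ^ 4 := by
    refine le_of_mul_le_mul_left ?_ hc; linarith
  have hP0 : 0 < P := lt_of_lt_of_le (by positivity) hP
  have hu1 : 1 ≤ u := by
    rw [hu]; exact (one_le_inv₀ hU).2 (by linarith)
  have hu2 : u ≤ 25 / 24 := by
    rw [hu, inv_le_comm₀ hU (by norm_num)]; norm_num; linarith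
  have hu0 : 0 < u := by linarith
  have hG : 0 < 2 * u ^ 3 + P := by positivity
  simp only [div_eq_mul_inv, ← inv_pow, ← hu]
  have e0 : c * (2 * u ^ 3) + c * P = c * (2 * u ^ 3 + P) := by ring
  have e1 : c * (6 * u ^ 4) + c * P₁ = c * (6 * u ^ 4 + P₁) := by ring
  have e2 : c * (24 * u ^ 5) + c * P₂ = c * (24 * u ^ 5 + P₂) := by ring
  rw [e0, e1, e2]
  have hform : c * (6 * u ^ 4 + P₁) * (c * (2 * u ^ 3 + P))⁻¹ +
      t * ((c * (24 * u ^ 5 + P₂) * (c * (2 * u ^ 3 + P)) -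
        c * (6 * u ^ 4 + P₁) * (c * (6 * u ^ 4 + P₁))) * (c * (2 * u ^ 3 + P))⁻¹ ^ 2) =
      ((6 * u ^ 4 + P₁) * (2 * u ^ 3 + P) + t * ((24 * u ^ 5 + P₂) * (2 * u ^ 3 + P) -
        (6 * u ^ 4 + P₁) ^ 2)) / (2 * u ^ 3 + P) ^ 2 := by
    field_simp
  rw [hform, div_lt_iff₀ (by positivity)]
  -- The terms free of P, P₁, P₂ cancel because u(1 - t) = 1: they express the ball's own identity.
  -- The last bracket is nonnegative as P₁ ≥ 0.
  have hid : 3 * u ^ 2 * (2 * u ^ 3 + P) ^ 2 - ((6 * u ^ 4 + P₁) * (2 * u ^ 3 + P) +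
      t * ((24 * u ^ 5 + P₂) * (2 * u ^ 3 + P) - (6 * u ^ 4 + P₁) ^ 2)) =
      6 * (1 - 3 * t) * u ^ 5 * P - (P₁ + t * P₂) * (2 * u ^ 3 + P) +
        (3 * u ^ 2 * P ^ 2 + 12 * t * u ^ 4 * P₁ + t * P₁ ^ 2) := by
    linear_combination (12 * u ^ 7 + 6 * u ^ 4 * P) * hut
  have hQ : P₁ + t * P₂ ≤ 28 * q ^ 3 := by
    have h1 : t * P₂ ≤ t * (96 * q ^ 4) := by gcongr
    have h2 : t * (96 * q ^ 4) ≤ 4 * q * (96 * q ^ 4) := by gcongr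
    have h3 : 4 * q * (96 * q ^ 4) = 384 * q ^ 2 * q ^ 3 := by ring
    have h4 : 384 * q ^ 2 * q ^ 3 ≤ 4 * q ^ 3 := by
      have : q ^ 2 ≤ (1 / 100) ^ 2 := by gcongr
      gcongr
      linarith
    linarith
  have hu3 : u ^ 3 ≤ 2 := by
    calc u ^ 3 ≤ (25 / 24) ^ 3 := by gcongr
      _ ≤ 2 := by norm_num
  have hu5 : 1 ≤ u ^ 5 := one_le_pow₀ hu1
  have hq3 : q ^ 3 ≤ q ^ 2 / 100 := by
    calc q ^ 3 = q ^ 2 * q := by ring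
      _ ≤ q ^ 2 * (1 / 100) := by gcongr
      _ = q ^ 2 / 100 := by ring
  have hrest : 0 ≤ 3 * u ^ 2 * P ^ 2 + 12 * t * u ^ 4 * P₁ + t * P₁ ^ 2 := by positivity
  have hA : 5 * P ≤ 6 * (1 - 3 * t) * u ^ 5 * P := by
    have h5 : 5 ≤ 6 * (1 - 3 * t) := by linarith
    calc 5 * P = 5 * 1 * P := by ring
      _ ≤ 6 * (1 - 3 * t) * u ^ 5 * P := by gcongr
  have hB : (P₁ + t * P₂) * (2 * u ^ 3 + P) ≤ 28 * q ^ 3 * (4 + P) := by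
    calc (P₁ + t * P₂) * (2 * u ^ 3 + P) ≤ 28 * q ^ 3 * (2 * u ^ 3 + P) := by gcongr
      _ ≤ 28 * q ^ 3 * (4 + P) := by gcongr; linarith
  have hC : 28 * q ^ 3 * (4 + P) ≤ 28 * (q ^ 2 / 100) * (4 + P) := by gcongr
  have hq2 : q ^ 2 ≤ 1 := pow_le_one₀ hq.le (by linarith)
  have hqP : q ^ 2 * P ≤ 1 * P := by gcongr
  -- As q² ≤ P/2 and q² ≤ 1, the left side is at most 0.56P + 0.28P.
  have hE : 28 * (q ^ 2 / 100) * (4 + P) < 5 * P := by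
    have : 28 * (q ^ 2 / 100) * (4 + P) = 112 / 100 * q ^ 2 + 28 / 100 * (q ^ 2 * P) := by ring
    linarith
  linarith

theorem powerSum_choose {t : ℝ} (ht : ‖t‖ < 1) (C : ℝ) (m : ℕ) :
    powerSum (fun k => C * ((k + m).choose m : ℝ)) t = C / (1 - t) ^ (m + 1) := by
  have := tsum_choose_mul_geometric_of_norm_lt_one m ht
  simp only [powerSum, RCLike.ofReal_real_eq_id, id_eq, mul_assoc]
  rw [tsum_mul_left, this]
  ring

theorem polyBounded_ballCoeff : PolyBounded ballCoeff := by
  refine ⟨2, 2, fun k => ?_⟩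
  have hk : (0 : ℝ) ≤ k := k.cast_nonneg
  rw [ballCoeff, abs_of_nonneg (by positivity)]
  nlinarith

theorem derivCoeff_add (a b : ℕ → ℝ) : derivCoeff (a + b) = derivCoeff a + derivCoeff b := by
  funext k
  simp [derivCoeff, mul_add]

theorem derivCoeff_smul (c : ℝ) (a : ℕ → ℝ) : derivCoeff (c • a) = c • derivCoeff a := by
  funext k
  simp [derivCoeff]
  ring

theorem PolyBounded.smul {a : ℕ → ℝ} (ha : PolyBounded a) (c : ℝ) : PolyBounded (c • a) := by
  obtain ⟨C, m, h⟩ := ha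
  refine ⟨|c| * C, m, fun k => ?_⟩
  rw [Pi.smul_apply, smul_eq_mul, abs_mul, mul_assoc]
  exact mul_le_mul_of_nonneg_left (h k) (abs_nonneg c)

theorem PolyBounded.mono {a b : ℕ → ℝ} (ha : PolyBounded a) (h : ∀ k, |b k| ≤ |a k|) :
    PolyBounded b := by
  obtain ⟨C, m, h'⟩ := ha
  exact ⟨C, m, fun k => (h k).trans (h' k)⟩

theorem PolyBounded.summable_real {a : ℕ → ℝ} (ha : PolyBounded a) {t : ℝ} (ht : ‖t‖ < 1) :
    Summable fun k => a k * t ^ k := by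
  simpa using (ha.norm_summable (𝕜 := ℝ) ht).of_norm

theorem powerSum_add {a b : ℕ → ℝ} (ha : PolyBounded a) (hb : PolyBounded b) {t : ℝ}
    (ht : ‖t‖ < 1) : powerSum (a + b) t = powerSum a t + powerSum b t := by
  simp only [powerSum, RCLike.ofReal_real_eq_id, id_eq, Pi.add_apply, add_mul]
  exact (ha.summable_real ht).tsum_add (hb.summable_real ht)

theorem powerSum_smul (c : ℝ) (a : ℕ → ℝ) (t : ℝ) : powerSum (c • a) t = c * powerSum a t := by
  simp only [powerSum, RCLike.ofReal_real_eq_id, id_eq, Pi.smul_apply, smul_eq_mul, mul_assoc]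
  exact tsum_mul_left

/-- Comparison of `∑ dₖ tᵏ` with `∑ aₖ (qt)ᵏ`. -/
theorem powerSum_le_of_le_geometric {a d : ℕ → ℝ} (ha : PolyBounded a) (hd : PolyBounded d)
    {q t K : ℝ} (hq0 : 0 ≤ q) (hq : q ≤ 1) (ht0 : 0 ≤ t) (ht : t < 1)
    (h : ∀ k, d k ≤ K * (q ^ k * a k)) : powerSum d t ≤ K * powerSum a (q * t) := by
  have htn : ‖t‖ < 1 := by rwa [Real.norm_of_nonneg ht0]
  have hqt : ‖q * t‖ < 1 := by
    rw [Real.norm_of_nonneg (by positivity)]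
    exact (mul_le_of_le_one_left ht0 hq).trans_lt ht
  simp only [powerSum, RCLike.ofReal_real_eq_id, id_eq]
  rw [← tsum_mul_left]
  refine (hd.summable_real htn).tsum_le_tsum (fun k => ?_) ((ha.summable_real hqt).mul_left K)
  calc d k * t ^ k ≤ K * (q ^ k * a k) * t ^ k := by
        have := h k
        gcongr
    _ = K * (a k * (q * t) ^ k) := by rw [mul_pow]; ring

theorem powerSum_nonneg {a : ℕ → ℝ} (ha : ∀ k, 0 ≤ a k) {t : ℝ} (ht : 0 ≤ t) :
    0 ≤ powerSum a t := by
  simp only [powerSum, RCLike.ofReal_real_eq_id, id_eq]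
  exact tsum_nonneg fun k => mul_nonneg (ha k) (pow_nonneg ht k)

theorem kernelCoeff_neg_one : kernelCoeff (-1) = (π ^ 2)⁻¹ • ballCoeff := by
  funext k
  simp [kernelCoeff, monomialNormSq, ballCoeff]
  field_simp

theorem radialLevi_ball {t : ℝ} (ht0 : 0 ≤ t) (ht : t < 1) :
    radialLevi (kernelCoeff (-1)) t = 3 / (1 - t) ^ 2 := by
  have htn : ‖t‖ < 1 := by rwa [Real.norm_of_nonneg ht0]
  have hU : 1 - t ≠ 0 := by linarith
  rw [radialLevi, kernelCoeff_neg_one, derivCoeff_smul, derivCoeff_smul, powerSum_smul,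
    powerSum_smul, powerSum_smul, derivCoeff_derivCoeff_ballCoeff_eq, derivCoeff_ballCoeff_eq,
    ballCoeff_eq, powerSum_choose htn, powerSum_choose htn, powerSum_choose htn]
  field_simp
  ring

/-- The difference of the kernel coefficients of the ring domain and of the ball. -/
noncomputable def excessCoeff (q : ℝ) (k : ℕ) : ℝ := ballCoeff k * (q ^ (k + 2) / (1 - q ^ (k + 2)))

theorem kernelCoeff_eq_add {r : ℝ} (hr0 : 0 < r) (hr : r < 7 / 10) :
    kernelCoeff r = (π ^ 2)⁻¹ • ballCoeff + (π ^ 2)⁻¹ • excessCoeff (r ^ 2) := by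
  funext k
  have h := max_pow_le_half hr k
  rw [max_eq_left hr0.le, pow_mul] at h
  have hne : 1 - (r ^ 2) ^ (k + 2) ≠ 0 := by linarith
  simp only [kernelCoeff, monomialNormSq, Pi.add_apply, Pi.smul_apply, excessCoeff, ballCoeff,
    max_eq_left hr0.le, smul_eq_mul, pow_mul r 2]
  field_simp
  ring

theorem ballCoeff_pos (k : ℕ) : 0 < ballCoeff k := by
  unfold ballCoeff; positivity

theorem excessCoeff_bounds {q : ℝ} (hq : 0 < q) (hq1 : q < 1 / 100) (k : ℕ) :
    0 ≤ excessCoeff q k ∧ excessCoeff q k ≤ 2 * q ^ (k + 2) * ballCoeff k ∧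
      q ^ (k + 2) * ballCoeff k ≤ excessCoeff q k := by
  have h : q ^ (k + 2) ≤ 1 / 2 := by
    calc q ^ (k + 2) ≤ q ^ 1 := pow_le_pow_of_le_one hq.le (by linarith) (by omega)
      _ ≤ 1 / 2 := by linarith
  have hp : 0 < q ^ (k + 2) := by positivity
  have hb := ballCoeff_pos k
  have h1 : q ^ (k + 2) / (1 - q ^ (k + 2)) ≤ 2 * q ^ (k + 2) := by
    rw [div_le_iff₀ (by linarith)]; nlinarith
  have h2 : q ^ (k + 2) ≤ q ^ (k + 2) / (1 - q ^ (k + 2)) := by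
    rw [le_div_iff₀ (by linarith)]; nlinarith
  unfold excessCoeff
  refine ⟨?_, ?_, ?_⟩
  · exact mul_nonneg hb.le (hp.le.trans h2)
  · rw [mul_comm _ (ballCoeff k)]; gcongr
  · rw [mul_comm _ (ballCoeff k)]; gcongr

theorem div_le_two_mul {a x : ℝ} (ha : 0 ≤ a) (hx : 1 / 2 ≤ x) : a / x ≤ 2 * a := by
  rw [div_le_iff₀ (by linarith)]
  nlinarith

/-- The excess coefficients are comparable to qᵏ⁺² times those of the ball. Each differentiation
shifts the index and so gains a factor q, giving the orders q², q³, q⁴. -/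
theorem radialLevi_ring_lt_ball {r : ℝ} (hr0 : 0 < r) (hr : r < 1 / 10) {t : ℝ} (ht0 : r ^ 2 < t)
    (ht : t < 4 * r ^ 2) : radialLevi (kernelCoeff r) t < radialLevi (kernelCoeff (-1)) t := by
  set q := r ^ 2 with hqdef
  have hq : 0 < q := by positivity
  have hq1 : q < 1 / 100 := by
    calc q < (1 / 10) ^ 2 := by rw [hqdef]; gcongr
      _ = 1 / 100 := by norm_num
  have htpos : 0 < t := hq.trans ht0
  have htlt : t < 1 := by linarith
  have htn : ‖t‖ < 1 := by rwa [Real.norm_of_nonneg htpos.le]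
  have hb := excessCoeff_bounds hq hq1
  have hB := polyBounded_ballCoeff
  have hE : PolyBounded (excessCoeff q) := (hB.smul 2).mono fun k => by
    rw [abs_of_nonneg (hb k).1, Pi.smul_apply, smul_eq_mul,
      abs_of_pos (mul_pos two_pos (ballCoeff_pos k))]
    refine (hb k).2.1.trans ?_
    have : q ^ (k + 2) ≤ 1 := pow_le_one₀ hq.le (by linarith)
    have := (ballCoeff_pos k).le
    calc 2 * q ^ (k + 2) * ballCoeff k ≤ 2 * 1 * ballCoeff k := by gcongr
      _ = _ := by ring
  have hc : (0 : ℝ) < (π ^ 2)⁻¹ := by positivity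
  have hqt0 : 0 ≤ q * t := by positivity
  have hqt : q * t ≤ 1 / 100 := by nlinarith
  have hqtn : ‖q * t‖ < 1 := by rw [Real.norm_of_nonneg hqt0]; linarith
  have hinv : ∀ m : ℕ, m ≤ 5 → 1 / 2 ≤ (1 - q * t) ^ m := fun m hm => by
    calc (1 / 2 : ℝ) ≤ (99 / 100) ^ 5 := by norm_num
      _ ≤ (99 / 100) ^ m := pow_le_pow_of_le_one (by norm_num) (by norm_num) hm
      _ ≤ _ := by gcongr; linarith
  -- The term k = 0 alone suffices, as `ballCoeff 0` is 2.
  have h0 : 2 * q ^ 2 ≤ powerSum (excessCoeff q) t := by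
    have h1 := (hE.summable_real htn).le_tsum 0
      fun k _ => mul_nonneg (hb k).1 (pow_nonneg htpos.le k)
    have h2 := (hb 0).2.2
    simp only [powerSum, RCLike.ofReal_real_eq_id, id_eq]
    refine le_trans ?_ h1
    simp only [ballCoeff] at h2
    norm_num at h2 ⊢
    linarith
  -- Comparison with 2q³ · 6/(1 - qt)⁴, whose denominator is at least 1/2; likewise 96 = 2 · 2 · 24
  -- for the second derivative.
  have h1 : powerSum (derivCoeff (excessCoeff q)) t ≤ 24 * q ^ 3 := by
    have := powerSum_le_of_le_geometric (K := 2 * q ^ 3) hB.derivCoeff hE.derivCoeff hq.le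
      (by linarith) htpos.le htlt fun k => by
        simp only [derivCoeff]
        have := (hb (k + 1)).2.1
        calc ((k : ℝ) + 1) * excessCoeff q (k + 1)
            ≤ ((k : ℝ) + 1) * (2 * q ^ (k + 1 + 2) * ballCoeff (k + 1)) := by gcongr
          _ = _ := by ring
    refine this.trans ?_
    rw [derivCoeff_ballCoeff_eq, powerSum_choose hqtn]
    have h4 := hinv (3 + 1) (by norm_num)
    calc 2 * q ^ 3 * (6 / (1 - q * t) ^ (3 + 1)) ≤ 2 * q ^ 3 * (2 * 6) := by
          gcongr
          exact div_le_two_mul (by norm_num) h4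
      _ = 24 * q ^ 3 := by ring
  have h2 : powerSum (derivCoeff (derivCoeff (excessCoeff q))) t ≤ 96 * q ^ 4 := by
    have := powerSum_le_of_le_geometric (K := 2 * q ^ 4) hB.derivCoeff.derivCoeff
      hE.derivCoeff.derivCoeff hq.le (by linarith) htpos.le htlt fun k => by
        simp only [derivCoeff]
        have := (hb (k + 1 + 1)).2.1
        calc ((k : ℝ) + 1) * ((((k + 1 : ℕ) : ℝ) + 1) * excessCoeff q (k + 1 + 1))
            ≤ ((k : ℝ) + 1) * ((((k + 1 : ℕ) : ℝ) + 1) *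
              (2 * q ^ (k + 1 + 1 + 2) * ballCoeff (k + 1 + 1))) := by gcongr
          _ = _ := by ring
    refine this.trans ?_
    rw [derivCoeff_derivCoeff_ballCoeff_eq, powerSum_choose hqtn]
    have h5 := hinv (4 + 1) le_rfl
    calc 2 * q ^ 4 * (24 / (1 - q * t) ^ (4 + 1)) ≤ 2 * q ^ 4 * (2 * 24) := by
          gcongr
          exact div_le_two_mul (by norm_num) h5
      _ = 96 * q ^ 4 := by ring
  have h1' : 0 ≤ powerSum (derivCoeff (excessCoeff q)) t :=
    powerSum_nonneg (fun k => mul_nonneg (by positivity) (hb (k + 1)).1) htpos.le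
  rw [radialLevi_ball htpos.le htlt, radialLevi, kernelCoeff_eq_add hr0 (by linarith)]
  simp only [derivCoeff_add, derivCoeff_smul]
  rw [powerSum_add (hB.smul _) (hE.smul _) htn,
    powerSum_add (hB.derivCoeff.smul _) (hE.derivCoeff.smul _) htn,
    powerSum_add (hB.derivCoeff.derivCoeff.smul _) (hE.derivCoeff.derivCoeff.smul _) htn]
  simp only [powerSum_smul]
  rw [derivCoeff_derivCoeff_ballCoeff_eq, derivCoeff_ballCoeff_eq, ballCoeff_eq,
    powerSum_choose htn, powerSum_choose htn, powerSum_choose htn]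
  refine radialLevi_perturbation hc hq hq1 htpos ht ?_ ?_ ?_ ?_
  · rw [mul_comm]; gcongr
  · positivity
  · rw [mul_comm]; gcongr
  · rw [mul_comm]; gcongr

/-- For all sufficiently small `r > 0`, the Bergman metric of the ring domain
`{r < |z| < 1}` in `ℂ²` is strictly smaller than that of the unit ball in the normal direction,
at all points close enough to the inner boundary. -/
theorem proposition4p2 :
    BergmanMetricDefined (unitBallCn 2) ∧
    ∃ r₀ : ℝ, 0 < r₀ ∧ r₀ < 1 ∧ ∀ r : ℝ, 0 < r → r < r₀ →
      BergmanMetricDefined (ringDomain 2 r) ∧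
      ∃ ε : ℝ, 0 < ε ∧ ∀ z₀ ∈ ringDomain 2 r, ‖z₀‖ < r + ε →
        bergmanMetric (ringDomain 2 r) z₀ (((‖z₀‖ : ℂ)⁻¹) • z₀)
          < bergmanMetric (unitBallCn 2) z₀ (((‖z₀‖ : ℂ)⁻¹) • z₀) := by
  have hneg : (-1 : ℝ) < 7 / 10 := by norm_num
  rw [unitBallCn_eq_ringDomain]
  -- The bound r < 1/10 gives q < 1/100, and ε = r gives ‖z‖² < 4r².
  refine ⟨bergmanMetricDefined_ringDomain hneg, 1 / 10, by norm_num, by norm_num,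
    fun r hr0 hr => ⟨bergmanMetricDefined_ringDomain (by linarith), r, hr0, fun z hz hzr => ?_⟩⟩
  have hzpos : 0 < ‖z‖ := hr0.trans hz.1
  have hz0 : z ≠ 0 := norm_pos_iff.1 hzpos
  have hlt : ‖z‖ ^ 2 < 1 := (sq_lt_one_iff₀ (norm_nonneg _)).2 hz.2
  unfold bergmanMetric
  rw [leviForm_ringDomain (by linarith) hz hz0,
    leviForm_ringDomain hneg (z := z) ⟨by linarith, hz.2⟩ hz0]
  -- Only the ball's Levi form has to be positive for the square roots to compare.
  refine (Real.sqrt_lt_sqrt_iff_of_pos ?_).2 ?_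
  · rw [radialLevi_ball (by positivity) hlt]
    have : 0 < 1 - ‖z‖ ^ 2 := by linarith
    positivity
  · have h1 : r ^ 2 < ‖z‖ ^ 2 := pow_lt_pow_left₀ hz.1 hr0.le two_ne_zero
    have h2 : ‖z‖ ^ 2 < (2 * r) ^ 2 := pow_lt_pow_left₀ (by linarith) hzpos.le two_ne_zero
    exact radialLevi_ring_lt_ball hr0 hr h1 (by linarith)
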